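/- Let $M$ be a (Hausdorff, $\sigma$-compact) smooth manifold, $A=C^\infty(M)$, $\mathfrak X(M)=\mathrm{Der}(A)$, $\Lambda^1=\mathfrak X(M)^*$. Let $C$ be an involutive distribution on $M$, with module of sections $C\mathfrak X$, and let $V$ be a complementary distribution, with module of sections $V\mathfrak X$, so that $\mathfrak X(M)=C\mathfrak X\oplus V\mathfrak X$. For $X\in\mathfrak X(M)$ write $X=X_C+X_V$ for the corresponding decomposition. Let $C\Lambda^1\subset\Lambda^1$ and $V\Lambda^1\subset\Lambda^1$ be the annihilators of $C\mathfrak X$ and $V\mathfrak X$, let $\overline\Lambda{}^1=\Lambda^1/C\Lambda^1$, and let $\overline\Lambda=\Lambda^\bullet_A\overline\Lambda{}^1$ be the algebra of longitudinal forms. Let $\nabla$ be a linear connection on $M$ which is * adapted to $(C,V)$: the induced $\nabla_X$ on $\Lambda^1$ preserves $C\Lambda^1$ and $V\Lambda^1$ for every $X\in\mathfrak X(M)$; for $Y\in V\mathfrak X$ and $\omega\in V\Lambda^1$, $\nabla_Y\omega$ is the component of the Lie derivative $L_Y\omega$ in $V\Lambda^1$; for $X\in C\mathfrak X$ and $\omega\in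 C\Lambda^1$, $\nabla_X\omega$ is the component of $L_X\omega$ in $C\Lambda^1$; * torsion-quasi-free: its torsion is $T(X,Y)=-[X_C,Y_C]_V-[X_V,Y_V]_C$ for all $X,Y\in\mathfrak X(M)$. Then $\nabla_X$ induces a degree $0$ derivation of $\overline\Lambda$ subordinate to $X$. For a symmetric contravariant tensor $P\in S^k\mathfrak X(M)$ let $\nabla_P=P^{a_1\cdots a_k}\nabla_{a_1}\cdots\nabla_{a_k}:\overline\Lambda\to\overline\Lambda$ be the contraction of $P$ with the $k$-th iterated covariant derivative. Let $\mathcal D(\overline\Lambda)$ be the algebra of (graded) differential operators on $\overline\Lambda$, and $\overline\Lambda\otimes\overline{\mathcal D}=\mathcal D(A,\overline\Lambda)/(\mathcal D(A,\overline\Lambda)\circ C\mathfrak X)$ the module of normal differential operators with values in $\overline\Lambda$, where $\mathcal D(A,\overline\Lambda)$ is the module of differential operators $A\to\overline\Lambda$. Let $p:\mathcal D(\overline\Lambda)\to\overline\Lambda\otimes\overline{\mathcal D}$ be the canonical projection, which maps $\square$ to the class of $\square|_A$. Put $\mathcal S=\overline\Lambda\otimes_A\Lambda^\bullet C\mathfrak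 X\otimes_A S^\bullet C\mathfrak X\otimes_A S^\bullet V\mathfrak X$, let $$\mathcal S_H=\bigoplus_{k+\ell+m=H}\overline\Lambda\otimes_A\Lambda^k C\mathfrak X\otimes_A S^\ell C\mathfrak X\otimes_A S^mV\mathfrak X ,$$ and let $p_0:\mathcal S\to\overline\Lambda\otimes_A S^\bullet V\mathfrak X$ be the obvious projection (onto the summands with $k=\ell=0$). The maps $$\mathsf{PBW}:\mathcal S\to\mathcal D(\overline\Lambda),\qquad \omega\otimes X_1\wedge\dots\wedge X_k\otimes P\otimes Q\mapsto\omega\, i_{X_1}\cdots i_{X_k}\nabla_{P\odot Q},$$ $$\underline{\mathsf{PBW}}:\overline\Lambda\otimes_A S^\bullet V\mathfrak X\to\overline\Lambda\otimes\overline{\mathcal D},\qquad \omega\otimes Q\mapsto\text{the class of } f\mapsto\omega\,\nabla_Q f,$$ carry the gradings $\mathcal S=\bigoplus_H\mathcal S_H$ and $\bigoplus_k\overline\Lambda\otimes_A S^kV\mathfrak X$ over to gradings by order of $\mathcal D(\overline\Lambda)$ and $\overline\Lambda\otimes\overline{\mathcal D}$. With respect to these gradings $p$ decomposes into homogeneous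 components $p^{[i]}$, $i\in\mathbb Z$: for $s\in\mathcal S_H$ there is an expansion $p(\mathsf{PBW}(s))=\sum_i\underline{\mathsf{PBW}}(\tau_i)$ with finitely many non-zero terms, $\tau_i\in\overline\Lambda\otimes_A S^{H+i}V\mathfrak X$ ($\tau_i=0$ if $H+i<0$), and $\tau_i$ corresponds to $p^{[i]}(\mathsf{PBW}(s))$. **Lemma.** The order $-1$ component of $p$ vanishes, $p^{[-1]}=0$, so that $p=p_0+\mathcal O(-2)$. In detail: for every $H\ge 0$ and $s\in\mathcal S_H$ there is an expansion as above with $\tau_i=0$ for $i>0$, $\tau_0=p_0(s)$ and $\tau_{-1}=0$; in particular $$p(\mathsf{PBW}(s))-\underline{\mathsf{PBW}}(p_0(s))\in\sum_{0\le j\le H-2}\underline{\mathsf{PBW}}\big(\overline\Lambda\otimes_A S^jV\mathfrak X\big).$$ -/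

import Mathlib

open scoped TensorProduct

set_option linter.unusedSectionVars false

noncomputable section

namespace FolPBW

section ExtDer
variable {A : Type*} [CommRing A] [Algebra ℝ A]
variable (N : Type*) [AddCommGroup N] [Module A N] 

/-- The ring of dual numbers over the exterior algebra of `N`, seen as an `A`-algebra through the
ring homomorphism `a ↦ a + ε θ(a)` attached to a derivation `θ` of `A`. -/
def Twisted (_θ : Derivation ℝ A A) : Type _ := DualNumber (ExteriorAlgebra A N)

variable {N} (θ : Derivation ℝ A A)

instance : Ring (Twisted N θ) := inferInstanceAs (Ring (DualNumber (ExteriorAlgebra A N)))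

def Twisted.mk (x y : ExteriorAlgebra A N) : Twisted N θ := (x, y)

variable {θ} in
def Twisted.fst (z : Twisted N θ) : ExteriorAlgebra A N := Prod.fst z
variable {θ} in
def Twisted.snd (z : Twisted N θ) : ExteriorAlgebra A N := Prod.snd z

namespace Twisted

variable {θ}

@[ext] theorem ext {z w : Twisted N θ} (h₁ : z.fst = w.fst) (h₂ : z.snd = w.snd) : z = w :=
  Prod.ext h₁ h₂

@[simp] theorem fst_mk (x y : ExteriorAlgebra A N) : (mk θ x y).fst = x := rfl
@[simp] theorem snd_mk (x y : ExteriorAlgebra A N) : (mk θ x y).snd = y := rfl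
@[simp] theorem fst_one : (1 : Twisted N θ).fst = 1 := rfl
@[simp] theorem snd_one : (1 : Twisted N θ).snd = 0 := rfl
@[simp] theorem fst_zero : (0 : Twisted N θ).fst = 0 := rfl
@[simp] theorem snd_zero : (0 : Twisted N θ).snd = 0 := rfl
@[simp] theorem fst_add (z w : Twisted N θ) : (z + w).fst = z.fst + w.fst := rfl
@[simp] theorem snd_add (z w : Twisted N θ) : (z + w).snd = z.snd + w.snd := rfl
@[simp] theorem fst_mul (z w : Twisted N θ) : (z * w).fst = z.fst * w.fst := rfl
@[simp] theorem snd_mul (z w : Twisted N θ) :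
    (z * w).snd = z.fst * w.snd + z.snd * w.fst := rfl

end Twisted

instance : Algebra A (Twisted N θ) := RingHom.toAlgebra'
  { toFun := fun a => Twisted.mk θ (algebraMap A _ a) (algebraMap A _ (θ a))
    map_one' := by ext <;> simp
    map_zero' := by ext <;> simp
    map_add' := fun a b => by ext <;> simp
    map_mul' := fun a b => by
      ext
      · simp
      · simp [← map_mul, mul_comm] }
  (fun a z => by
    ext
    · exact Algebra.commutes a _
    · change algebraMap A _ a * z.snd + algebraMap A _ (θ a) * z.fst
        = z.fst * algebraMap A _ (θ a) + z.snd * algebraMap A _ a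
      rw [Algebra.commutes a, Algebra.commutes (θ a), add_comm])

theorem Twisted.algebraMap_eq (a : A) : algebraMap A (Twisted N θ) a =
    Twisted.mk θ (algebraMap A _ a) (algebraMap A _ (θ a)) := rfl

variable [Module ℝ N] [IsScalarTower ℝ A N]

/-- An operator on a module subordinate to a derivation of the ring. -/
def IsSubordinate (δ : N →ₗ[ℝ] N) : Prop := ∀ (a : A) (n : N), δ (a • n) = θ a • n + a • δ n

variable {θ} {δ : N →ₗ[ℝ] N} (hδ : IsSubordinate θ δ)

def twistedLift : ExteriorAlgebra A N →ₐ[A] Twisted N θ :=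
  ExteriorAlgebra.lift A ⟨
    { toFun := fun n => Twisted.mk θ (ExteriorAlgebra.ι A n) (ExteriorAlgebra.ι A (δ n))
      map_add' := fun m n => by ext <;> simp
      map_smul' := fun a n => by
        rw [Algebra.smul_def, Twisted.algebraMap_eq]
        ext
        · simp [Algebra.smul_def]
        · simp [hδ a n, Algebra.smul_def, add_comm] },
    fun n => by
      ext
      · simp
      · simp [ExteriorAlgebra.ι_add_mul_swap]⟩

theorem fst_twistedLift (x : ExteriorAlgebra A N) : (twistedLift hδ x).fst = x := by
  induction x using ExteriorAlgebra.induction with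
  | algebraMap a => rw [AlgHom.commutes]; rfl
  | ι n => rw [twistedLift, ExteriorAlgebra.lift_ι_apply]; rfl
  | mul a b ha hb => rw [map_mul, Twisted.fst_mul, ha, hb]
  | add a b ha hb => rw [map_add, Twisted.fst_add, ha, hb]

/-- The derivation of the exterior algebra of `N` which restricts to `θ` on `A` and to `δ`
on `N`. -/
def extDer : ExteriorAlgebra A N →ₗ[ℝ] ExteriorAlgebra A N where
  toFun x := (twistedLift hδ x).snd
  map_add' x y := by rw [map_add, Twisted.snd_add]
  map_smul' c x := by
    rw [← algebraMap_smul A c x, map_smul, Algebra.smul_def, Twisted.algebraMap_eq]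
    simp [Algebra.smul_def, IsScalarTower.algebraMap_apply ℝ A (ExteriorAlgebra A N)]

@[simp] theorem extDer_algebraMap (a : A) :
    extDer hδ (algebraMap A _ a) = algebraMap A _ (θ a) := by
  change (twistedLift hδ (algebraMap A _ a)).snd = _
  rw [AlgHom.commutes]; rfl

@[simp] theorem extDer_ι (n : N) :
    extDer hδ (ExteriorAlgebra.ι A n) = ExteriorAlgebra.ι A (δ n) := by
  change (twistedLift hδ _).snd = _
  rw [twistedLift, ExteriorAlgebra.lift_ι_apply]; rfl

theorem extDer_mul (x y : ExteriorAlgebra A N) :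
    extDer hδ (x * y) = extDer hδ x * y + x * extDer hδ y := by
  change (twistedLift hδ _).snd = _
  rw [map_mul, Twisted.snd_mul, fst_twistedLift, fst_twistedLift, add_comm]; rfl

end ExtDer
section SymLift
variable {A : Type*} [CommRing A] [Algebra ℝ A]
variable {X W : Type*} [AddCommGroup X] [Module A X] [AddCommGroup W] [Module A W]

def symmetrize {k : ℕ} (φ : MultilinearMap A (fun _ : Fin k => X) W) :
    MultilinearMap A (fun _ : Fin k => X) W :=
  algebraMap ℝ A ((k.factorial : ℝ)⁻¹) • ∑ σ : Equiv.Perm (Fin k), φ.domDomCongr σ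

theorem symmetrize_comp_perm {k : ℕ} (φ : MultilinearMap A (fun _ : Fin k => X) W)
    (τ : Equiv.Perm (Fin k)) (v : Fin k → X) : symmetrize φ (v ∘ τ) = symmetrize φ v := by
  simp only [symmetrize, smul_apply, sum_apply,
    MultilinearMap.domDomCongr_apply, Function.comp_apply]
  congr 1
  exact Fintype.sum_equiv (Equiv.mulLeft τ) _ _ (fun σ => rfl)

def tensorLift (φ : ∀ k : ℕ, MultilinearMap A (fun _ : Fin k => X) W) : TensorAlgebra A X →ₗ[A] W :=
  DirectSum.toModule A ℕ W (fun k => PiTensorProduct.lift (φ k)) ∘ₗ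
    (TensorAlgebra.toDirectSum (R := A) (M := X)).toLinearMap

theorem tensorLift_tprod (φ : ∀ k : ℕ, MultilinearMap A (fun _ : Fin k => X) W) {k : ℕ}
    (v : Fin k → X) : tensorLift φ (TensorAlgebra.tprod A X k v) = φ k v := by
  simp only [tensorLift, LinearMap.comp_apply, AlgHom.toLinearMap_apply]
  rw [TensorAlgebra.toDirectSum_tensorPower_tprod, ← DirectSum.lof_eq_of A,
    DirectSum.toModule_lof, PiTensorProduct.lift.tprod]

theorem tensorLift_list (φ : ∀ k : ℕ, MultilinearMap A (fun _ : Fin k => X) W) (l : List X) :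
    tensorLift φ (l.map (TensorAlgebra.ι A)).prod = φ l.length l.get := by
  rw [← tensorLift_tprod φ, TensorAlgebra.tprod_apply]
  congr 2
  conv_lhs => rw [← List.ofFn_get l, List.map_ofFn]
  rfl

theorem tensorLift_symm_list (φ : ∀ k : ℕ, MultilinearMap A (fun _ : Fin k => X) W)
    (l₁ l₂ : List X) (x y : X) :
    tensorLift (fun k => symmetrize (φ k))
        ((l₁ ++ x :: y :: l₂).map (TensorAlgebra.ι A)).prod =
      tensorLift (fun k => symmetrize (φ k))
        ((l₁ ++ y :: x :: l₂).map (TensorAlgebra.ι A)).prod := by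
  have key : ∀ v : Fin (l₁ ++ x :: y :: l₂).length → X,
      List.ofFn v = l₁ ++ y :: x :: l₂ →
      symmetrize (φ (l₁ ++ x :: y :: l₂).length) (l₁ ++ x :: y :: l₂).get =
        symmetrize (φ (l₁ ++ x :: y :: l₂).length) v →
      tensorLift (fun k => symmetrize (φ k))
          ((l₁ ++ x :: y :: l₂).map (TensorAlgebra.ι A)).prod =
        tensorLift (fun k => symmetrize (φ k))
          ((l₁ ++ y :: x :: l₂).map (TensorAlgebra.ι A)).prod := by
    intro v hv h
    rw [tensorLift_list, h, ← hv, ← tensorLift_tprod (fun k => symmetrize (φ k)) v,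
      TensorAlgebra.tprod_apply, List.map_ofFn]
    rfl
  have hi : l₁.length < (l₁ ++ x :: y :: l₂).length := by simp
  have hj : l₁.length + 1 < (l₁ ++ x :: y :: l₂).length := by simp
  refine key ((l₁ ++ x :: y :: l₂).get ∘ Equiv.swap ⟨_, hi⟩ ⟨_, hj⟩) ?_
    (symmetrize_comp_perm _ _ _).symm
  apply List.ext_getElem
  · simp only [List.length_ofFn, List.length_append, List.length_cons]
  · intro n h₁ h₂
    simp only [List.getElem_ofFn, Function.comp_apply, List.get_eq_getElem]
    rcases lt_trichotomy n l₁.length with h | h | h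
    · rw [Equiv.swap_apply_of_ne_of_ne (by simp [Fin.ext_iff]; omega)
        (by simp [Fin.ext_iff]; omega)]
      simp [List.getElem_append_left, h]
    · subst h
      rw [Equiv.swap_apply_left]
      simp
    · by_cases h' : n = l₁.length + 1
      · subst h'
        rw [Equiv.swap_apply_right]
        simp
      · rw [Equiv.swap_apply_of_ne_of_ne (by simp [Fin.ext_iff]; omega)
          (by simp [Fin.ext_iff]; omega)]
        obtain ⟨m, rfl⟩ : ∃ m, n = l₁.length + 1 + 1 + m := ⟨n - (l₁.length + 1 + 1), by omega⟩
        simp only [List.getElem_append_right (show l₁.length ≤ l₁.length + 1 + 1 + m by omega),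
          show l₁.length + 1 + 1 + m - l₁.length = m + 1 + 1 by omega, List.getElem_cons_succ]

theorem span_listProd : Submodule.span A
    (Set.range fun l : List X => (l.map (TensorAlgebra.ι A)).prod) = ⊤ := by
  rw [eq_top_iff]
  rintro a -
  induction a using TensorAlgebra.induction with
  | algebraMap r =>
    rw [Algebra.algebraMap_eq_smul_one]
    exact Submodule.smul_mem _ _ (Submodule.subset_span ⟨[], by simp⟩)
  | ι x => exact Submodule.subset_span ⟨[x], by simp⟩
  | mul a b ha hb =>
    have := Submodule.mul_mem_mul ha hb
    rw [Submodule.span_mul_span] at this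
    refine Submodule.span_mono ?_ this
    rintro _ ⟨_, ⟨l, rfl⟩, _, ⟨m, rfl⟩, rfl⟩
    exact ⟨l ++ m, by simp⟩
  | add a b ha hb => exact Submodule.add_mem _ ha hb

theorem tensorLift_swap (φ : ∀ k : ℕ, MultilinearMap A (fun _ : Fin k => X) W)
    (a b : TensorAlgebra A X) (x y : X) :
    tensorLift (fun k => symmetrize (φ k))
        (a * (TensorAlgebra.ι A x * TensorAlgebra.ι A y) * b) =
      tensorLift (fun k => symmetrize (φ k))
        (a * (TensorAlgebra.ι A y * TensorAlgebra.ι A x) * b) := by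
  have ha : a ∈ Submodule.span A
    (Set.range fun l : List X => (l.map (TensorAlgebra.ι A)).prod) := by rw [span_listProd]; trivial
  have hb : b ∈ Submodule.span A
    (Set.range fun l : List X => (l.map (TensorAlgebra.ι A)).prod) := by rw [span_listProd]; trivial
  induction ha using Submodule.span_induction with
  | zero => simp
  | add a a' _ _ h h' => simp only [add_mul, map_add, h, h']
  | smul r a _ h => simp only [smul_mul_assoc, map_smul, h]
  | mem a ha =>
    obtain ⟨l, rfl⟩ := ha
    induction hb using Submodule.span_induction with
    | zero => simp
    | add a a' _ _ h h' => simp only [mul_add, map_add, h, h']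
    | smul r a _ h => simp only [mul_smul_comm, map_smul, h]
    | mem b hb =>
      obtain ⟨m, rfl⟩ := hb
      have := tensorLift_symm_list φ l m x y
      simpa [mul_assoc] using this

theorem tensorLift_eq_of_symRel (φ : ∀ k : ℕ, MultilinearMap A (fun _ : Fin k => X) W)
    {u v : TensorAlgebra A X} (h : TensorAlgebra.symRingCon A X u v) :
    ∀ a b : TensorAlgebra A X, tensorLift (fun k => symmetrize (φ k)) (a * u * b) =
      tensorLift (fun k => symmetrize (φ k)) (a * v * b) := by
  have h' : RingConGen.Rel (TensorAlgebra.SymRel A X) u v := h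
  clear h
  induction h' with
  | of u v hr =>
    obtain ⟨x, y⟩ := hr
    exact fun a b => tensorLift_swap φ a b x y
  | refl u => exact fun _ _ => rfl
  | symm _ ih => exact fun a b => (ih a b).symm
  | trans h₁ h₂ ih₁ ih₂ => exact fun a b => (ih₁ a b).trans (ih₂ a b)
  | add h₁ h₂ ih₁ ih₂ =>
    intro a b
    simp only [mul_add, add_mul, map_add, ih₁ a b, ih₂ a b]
  | @mul u v u' v' h₁ h₂ ih₁ ih₂ =>
    intro a b
    calc _ = tensorLift (fun k => symmetrize (φ k)) (a * u * (u' * b)) := by simp only [mul_assoc]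
      _ = tensorLift (fun k => symmetrize (φ k)) (a * v * (u' * b)) := ih₁ _ _
      _ = tensorLift (fun k => symmetrize (φ k)) ((a * v) * u' * b) := by simp only [mul_assoc]
      _ = _ := by rw [ih₂]; simp only [mul_assoc]

/-- The linear map on the symmetric algebra whose value on `x₁ ⊙ ⋯ ⊙ xₖ` is the symmetrization
`1/k! ∑_σ φₖ(x_σ(1), …, x_σ(k))`. -/
def symLift (φ : ∀ k : ℕ, MultilinearMap A (fun _ : Fin k => X) W) :
    SymmetricAlgebra A X →ₗ[A] W where
  toFun := Quotient.lift (tensorLift (fun k => symmetrize (φ k))) (fun u v h => by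
    simpa using tensorLift_eq_of_symRel φ h 1 1)
  map_add' a b := by
    obtain ⟨a, rfl⟩ := SymmetricAlgebra.algHom_surjective A X a
    obtain ⟨b, rfl⟩ := SymmetricAlgebra.algHom_surjective A X b
    exact map_add (tensorLift (fun k => symmetrize (φ k))) a b
  map_smul' r a := by
    obtain ⟨a, rfl⟩ := SymmetricAlgebra.algHom_surjective A X a
    exact map_smul (tensorLift (fun k => symmetrize (φ k))) r a

theorem symLift_prod (φ : ∀ k : ℕ, MultilinearMap A (fun _ : Fin k => X) W) {k : ℕ}
    (v : Fin k → X) :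
    symLift φ (List.ofFn fun i => SymmetricAlgebra.ι A X (v i)).prod =
      algebraMap ℝ A ((k.factorial : ℝ)⁻¹) •
        ∑ σ : Equiv.Perm (Fin k), φ k fun i => v (σ i) := by
  have h : (List.ofFn fun i => SymmetricAlgebra.ι A X (v i)).prod =
      SymmetricAlgebra.algHom A X (TensorAlgebra.tprod A X k v) := by
    rw [TensorAlgebra.tprod_apply, map_list_prod, List.map_ofFn]; rfl
  rw [h]
  change tensorLift (fun k => symmetrize (φ k)) _ = _
  rw [tensorLift_tprod]
  simp [symmetrize]

theorem symLift_mem (φ : ∀ k : ℕ, MultilinearMap A (fun _ : Fin k => X) W) (S : Submodule A W)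
    (h : ∀ k v, φ k v ∈ S) (P : SymmetricAlgebra A X) : symLift φ P ∈ S := by
  obtain ⟨a, rfl⟩ := SymmetricAlgebra.algHom_surjective A X P
  change tensorLift (fun k => symmetrize (φ k)) a ∈ S
  have ha : a ∈ Submodule.span A
    (Set.range fun l : List X => (l.map (TensorAlgebra.ι A)).prod) := by rw [span_listProd]; trivial
  induction ha using Submodule.span_induction with
  | zero => simp
  | add a a' _ _ h h' => rw [map_add]; exact add_mem h h'
  | smul r a _ h => rw [map_smul]; exact S.smul_mem r h
  | mem a ha =>
    obtain ⟨l, rfl⟩ := ha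
    dsimp only
    rw [tensorLift_list]
    simp only [symmetrize, smul_apply, sum_apply, MultilinearMap.domDomCongr_apply]
    exact S.smul_mem _ (sum_mem fun σ _ => h _ _)

end SymLift

section CovIter
variable {A : Type*} [CommRing A] [Algebra ℝ A]
variable {X W : Type*} [AddCommGroup X] [Module A X] [Module ℝ X] [IsScalarTower ℝ A X]
  [AddCommGroup W] [Module A W] [Module ℝ W] [IsScalarTower ℝ A W]

/-- The derivative of a `W`-valued tensor with `k` arguments in `X`, for operators `D` on `W` and
`δ` on `X` subordinate to the same derivation:
`v ↦ D (φ (v₁, …, vₖ)) - ∑ᵢ φ (v₁, …, δ vᵢ, …, vₖ)`. -/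
def covStep {θ : Derivation ℝ A A} {D : W →ₗ[ℝ] W} (hD : IsSubordinate θ D)
    {δ : X →ₗ[ℝ] X} (hδ : IsSubordinate θ δ) {k : ℕ}
    (φ : MultilinearMap A (fun _ : Fin k => X) W) : MultilinearMap A (fun _ : Fin k => X) W where
  toFun v := D (φ v) - ∑ i, φ (Function.update v i (δ (v i)))
  map_update_add' {hdec} v j x y := by
    have hdec' : hdec = instDecidableEqFin k := Subsingleton.elim _ _
    subst hdec'
    have h : ∀ i, φ (Function.update (Function.update v j (x + y)) i
          (δ (Function.update v j (x + y) i))) =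
        φ (Function.update (Function.update v j x) i (δ (Function.update v j x i))) +
        φ (Function.update (Function.update v j y) i (δ (Function.update v j y i))) := by
      intro i
      by_cases hij : i = j
      · subst hij; simp
      · simp only [Function.update_of_ne hij, Function.update_comm (Ne.symm hij),
          MultilinearMap.map_update_add]
    simp only [h, MultilinearMap.map_update_add, map_add, Finset.sum_add_distrib]
    abel
  map_update_smul' {hdec} v j a x := by
    have hdec' : hdec = instDecidableEqFin k := Subsingleton.elim _ _
    subst hdec'
    have h : ∀ i, φ (Function.update (Function.update v j (a • x)) i
          (δ (Function.update v j (a • x) i))) =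
        a • φ (Function.update (Function.update v j x) i (δ (Function.update v j x i))) +
        (if i = j then θ a • φ (Function.update v j x) else 0) := by
      intro i
      by_cases hij : i = j
      · subst hij; simp [hδ a x, add_comm]
      · simp only [Function.update_of_ne hij, Function.update_comm (Ne.symm hij),
          MultilinearMap.map_update_smul, if_neg hij, add_zero]
    simp only [h, MultilinearMap.map_update_smul, Finset.sum_add_distrib, hD a,
      Finset.sum_ite_eq', Finset.mem_univ, if_true, smul_sub, Finset.smul_sum]
    abel

end CovIter

section DiffOp
variable (A : Type*) [CommRing A] [Algebra ℝ A]

section Functions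
variable (Q : Type*) [AddCommGroup Q] [Module A Q] [Module ℝ Q] [IsScalarTower ℝ A Q]

/-- The commutator `φ ↦ [a, φ] = a ∘ φ - φ ∘ a` with the multiplications by `a`. -/
def fnComm (a : A) : (A →ₗ[ℝ] Q) →ₗ[A] (A →ₗ[ℝ] Q) where
  toFun φ := a • φ - φ ∘ₗ LinearMap.mulLeft ℝ a
  map_add' φ ψ := by ext; simp; abel
  map_smul' c φ := by ext; simp [smul_sub, smul_comm a c]

/-- Differential operators `A → Q` of order at most `k`: all `(k + 1)`-fold commutators with
elements of `A` vanish. -/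
def fnDiffOpOrder : ℕ → Submodule A (A →ₗ[ℝ] Q)
  | 0 => ⨅ a : A, (⊥ : Submodule A (A →ₗ[ℝ] Q)).comap (fnComm A Q a)
  | k + 1 => ⨅ a : A, (fnDiffOpOrder k).comap (fnComm A Q a)

/-- The module `𝒟(A, Q)` of differential operators `A → Q`. -/
def fnDiffOp : Submodule A (A →ₗ[ℝ] Q) := ⨆ k, fnDiffOpOrder A Q k

end Functions

section Graded
variable (N : Type*) [AddCommGroup N] [Module A N] [Module ℝ N] [IsScalarTower ℝ A N]

/-- The parity operator `ω ↦ (-1)^|ω| ω`. -/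
def parity : Module.End ℝ (ExteriorAlgebra A N) :=
  (CliffordAlgebra.involute (Q := (0 : QuadraticForm A N))).toLinearMap.restrictScalars ℝ

/-- The graded commutator `φ ↦ [a, φ] = a ∘ φ - (-1)^{i|φ|} φ ∘ a` with the multiplication by an
element `a` of degree `i`.  The sign is implemented by conjugation with the `i`-th power of the
parity operator, which multiplies an operator of degree `|φ|` by `(-1)^{i|φ|}`. -/
def gradedComm (i : ℕ) (a : ExteriorAlgebra A N) :
    Module.End ℝ (ExteriorAlgebra A N) →ₗ[A] Module.End ℝ (ExteriorAlgebra A N) where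
  toFun φ := LinearMap.mulLeft ℝ a * φ -
    (parity A N ^ i * φ * parity A N ^ i) * LinearMap.mulLeft ℝ a
  map_add' φ ψ := by simp only [mul_add, add_mul]; abel
  map_smul' c φ := by
    have h : ∀ (j : ℕ) (x : ExteriorAlgebra A N),
        (parity A N ^ j) (c • x) = c • (parity A N ^ j) x := by
      intro j
      induction j with
      | zero => intro x; simp
      | succ j ih =>
        intro x
        rw [pow_succ', Module.End.mul_apply, ih, Module.End.mul_apply]
        exact map_smul (CliffordAlgebra.involute (Q := (0 : QuadraticForm A N))) c _
    ext x
    simp [h, smul_sub]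

/-- Differential operators of order at most `k` on the graded algebra `ExteriorAlgebra A N`: all
`(k + 1)`-fold graded commutators with homogeneous elements vanish. -/
def diffOpOrder : ℕ → Submodule A (Module.End ℝ (ExteriorAlgebra A N))
  | 0 => ⨅ (i : ℕ) (a : ⋀[A]^i N), (⊥ : Submodule A _).comap (gradedComm A N i a)
  | k + 1 => ⨅ (i : ℕ) (a : ⋀[A]^i N), (diffOpOrder k).comap (gradedComm A N i a)

/-- The algebra `𝒟(Λ)` of differential operators on `Λ = ExteriorAlgebra A N`. -/
def diffOp : Submodule A (Module.End ℝ (ExteriorAlgebra A N)) := ⨆ k, diffOpOrder A N k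

variable {A N}

theorem mem_diffOpOrder_zero {φ : Module.End ℝ (ExteriorAlgebra A N)} :
    φ ∈ diffOpOrder A N 0 ↔ ∀ (i : ℕ), ∀ a ∈ ⋀[A]^i N, gradedComm A N i a φ = 0 := by
  simp [diffOpOrder, Submodule.mem_iInf]

theorem mem_diffOpOrder_succ {k : ℕ} {φ : Module.End ℝ (ExteriorAlgebra A N)} :
    φ ∈ diffOpOrder A N (k + 1) ↔
      ∀ (i : ℕ), ∀ a ∈ ⋀[A]^i N, gradedComm A N i a φ ∈ diffOpOrder A N k := by
  simp [diffOpOrder, Submodule.mem_iInf]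

theorem diffOpOrder_le_succ (k : ℕ) : diffOpOrder A N k ≤ diffOpOrder A N (k + 1) := by
  induction k with
  | zero =>
    intro φ h
    rw [mem_diffOpOrder_zero] at h
    rw [mem_diffOpOrder_succ]
    intro i a ha
    rw [h i a ha]; exact zero_mem _
  | succ k ih =>
    intro φ h
    rw [mem_diffOpOrder_succ] at h ⊢
    exact fun i a ha => ih (h i a ha)

theorem diffOpOrder_mono : Monotone (diffOpOrder A N) := monotone_nat_of_le_succ diffOpOrder_le_succ

theorem mem_diffOp {φ : Module.End ℝ (ExteriorAlgebra A N)} :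
    φ ∈ diffOp A N ↔ ∃ k, φ ∈ diffOpOrder A N k :=
  Submodule.mem_iSup_of_directed _ diffOpOrder_mono.directed_le

@[simp] theorem parity_apply (x : ExteriorAlgebra A N) :
    parity A N x = CliffordAlgebra.involute (Q := (0 : QuadraticForm A N)) x := rfl

theorem parity_sq : parity A N * parity A N = 1 := by
  ext x; simp

theorem parity_pow_mul_self (i : ℕ) : parity A N ^ i * parity A N ^ i = 1 := by
  rw [← (Commute.refl (parity A N)).mul_pow, parity_sq, one_pow]

theorem gradedComm_mul (i : ℕ) (a : ExteriorAlgebra A N)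
    (φ ψ : Module.End ℝ (ExteriorAlgebra A N)) :
    gradedComm A N i a (φ * ψ) = gradedComm A N i a φ * ψ +
      (parity A N ^ i * φ * parity A N ^ i) * gradedComm A N i a ψ := by
  change LinearMap.mulLeft ℝ a * (φ * ψ) - (parity A N ^ i * (φ * ψ) * parity A N ^ i) *
      LinearMap.mulLeft ℝ a = (LinearMap.mulLeft ℝ a * φ - (parity A N ^ i * φ * parity A N ^ i) *
      LinearMap.mulLeft ℝ a) * ψ + (parity A N ^ i * φ * parity A N ^ i) *
      (LinearMap.mulLeft ℝ a * ψ - (parity A N ^ i * ψ * parity A N ^ i) * LinearMap.mulLeft ℝ a)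
  have h : parity A N ^ i * (φ * ψ) * parity A N ^ i =
      (parity A N ^ i * φ * parity A N ^ i) * (parity A N ^ i * ψ * parity A N ^ i) := by
    calc _ = parity A N ^ i * φ * 1 * ψ * parity A N ^ i := by simp only [mul_assoc, one_mul]
      _ = _ := by rw [← parity_pow_mul_self i]; simp only [mul_assoc]
  rw [h]
  simp only [sub_mul, mul_sub, mul_assoc]
  abel

/-- Parity conjugation preserves the order. -/
theorem parity_conj_mulLeft (i : ℕ) (a : ExteriorAlgebra A N) :
    parity A N ^ i * LinearMap.mulLeft ℝ a * parity A N ^ i =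
      LinearMap.mulLeft ℝ ((parity A N ^ i) a) := by
  have h1 : ∀ (j : ℕ) (x y : ExteriorAlgebra A N),
      (parity A N ^ j) (x * y) = (parity A N ^ j) x * (parity A N ^ j) y := by
    intro j
    induction j with
    | zero => intro x y; simp
    | succ j ih => intro x y; simp [pow_succ', ih]
  ext x
  simp only [Module.End.mul_apply, LinearMap.mulLeft_apply, h1]
  rw [← Module.End.mul_apply (parity A N ^ i) (parity A N ^ i), parity_pow_mul_self]
  simp

theorem parity_mem {i : ℕ} {a : ExteriorAlgebra A N} (ha : a ∈ ⋀[A]^i N) :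
    parity A N a = (-1 : ℤˣ) ^ i • a := by
  induction ha using Submodule.pow_induction_on_left' with
  | algebraMap r => simp
  | add x y i hx hy h1 h2 => rw [map_add, h1, h2, smul_add]
  | mem_mul m hm i x hx h =>
    obtain ⟨n, rfl⟩ := hm
    rw [parity_apply] at h ⊢
    rw [map_mul, h]
    erw [CliffordAlgebra.involute_ι]
    rw [pow_succ', mul_smul, Units.smul_def, Units.smul_def, Units.smul_def, mul_smul_comm]
    simp

theorem parity_pow_mem (j : ℕ) {i : ℕ} {a : ExteriorAlgebra A N} (ha : a ∈ ⋀[A]^i N) :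
    (parity A N ^ j) a = (-1 : ℤˣ) ^ (i * j) • a := by
  induction j with
  | zero => simp
  | succ j ih =>
    rw [pow_succ', Module.End.mul_apply, ih, Units.smul_def, map_zsmul, parity_mem ha,
      ← Units.smul_def, smul_smul, ← pow_add, mul_add, mul_one]

theorem diffOpOrder_conj (k j : ℕ) {φ : Module.End ℝ (ExteriorAlgebra A N)}
    (h : φ ∈ diffOpOrder A N k) : parity A N ^ j * φ * parity A N ^ j ∈ diffOpOrder A N k := by
  have key : ∀ (i : ℕ) (a : ExteriorAlgebra A N), a ∈ ⋀[A]^i N →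
      ∀ φ : Module.End ℝ (ExteriorAlgebra A N),
      gradedComm A N i a (parity A N ^ j * φ * parity A N ^ j) =
        (-1 : ℤˣ) ^ (i * j) • (parity A N ^ j * gradedComm A N i a φ * parity A N ^ j) := by
    intro i a ha φ
    have h1 : LinearMap.mulLeft ℝ a = (-1 : ℤˣ) ^ (i * j) •
        (parity A N ^ j * LinearMap.mulLeft ℝ a * parity A N ^ j) := by
      rw [parity_conj_mulLeft, parity_pow_mem j ha]
      ext x
      simp only [LinearMap.mulLeft_apply, LinearMap.smul_apply, Units.smul_def, smul_mul_assoc,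
        smul_smul, ← Units.val_mul, ← pow_add]
      rw [Even.neg_one_pow ⟨_, rfl⟩]; simp
    have h2 : parity A N ^ j * parity A N ^ j = 1 := parity_pow_mul_self j
    have h3 : parity A N ^ i * parity A N ^ j = parity A N ^ j * parity A N ^ i :=
      (Commute.refl (parity A N)).pow_pow i j
    change LinearMap.mulLeft ℝ a * (parity A N ^ j * φ * parity A N ^ j) -
      (parity A N ^ i * (parity A N ^ j * φ * parity A N ^ j) * parity A N ^ i) *
        LinearMap.mulLeft ℝ a = _ • (parity A N ^ j * (LinearMap.mulLeft ℝ a * φ -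
      (parity A N ^ i * φ * parity A N ^ i) * LinearMap.mulLeft ℝ a) * parity A N ^ j)
    generalize parity A N ^ j = P at *
    generalize parity A N ^ i = R at *
    generalize LinearMap.mulLeft ℝ a = m at *
    generalize (-1 : ℤˣ) ^ (i * j) = s at *
    have e1 : m * (P * φ * P) = s • (P * (m * φ) * P) := by
      calc m * (P * φ * P) = (s • (P * m * P)) * (P * φ * P) := by rw [← h1]
        _ = s • (P * m * (P * P) * φ * P) := by
          simp only [Units.smul_def, smul_mul_assoc, mul_assoc]
        _ = _ := by rw [h2]; simp only [mul_assoc, mul_one]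
    have e2 : (R * (P * φ * P) * R) * m = s • (P * ((R * φ * R) * m) * P) := by
      calc (R * (P * φ * P) * R) * m = (R * P) * φ * (P * R) * (s • (P * m * P)) := by
            rw [← h1]; simp only [mul_assoc]
        _ = s • ((P * R) * φ * (R * P) * (P * m * P)) := by
          rw [h3, Units.smul_def, Units.smul_def, mul_smul_comm]
        _ = s • (P * R * φ * R * (P * P) * m * P) := by simp only [mul_assoc]
        _ = _ := by rw [h2]; simp only [mul_assoc, mul_one]
    rw [e1, e2]
    simp only [Units.smul_def, mul_sub, sub_mul, smul_sub]
  induction k generalizing φ with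
  | zero =>
    rw [mem_diffOpOrder_zero] at h ⊢
    intro i a ha
    rw [key i a ha, h i a ha]; simp
  | succ k ih =>
    rw [mem_diffOpOrder_succ] at h ⊢
    intro i a ha
    rw [key i a ha, Units.smul_def]
    exact zsmul_mem (ih (h i a ha)) _

theorem mul_mem_diffOpOrder {k l : ℕ} {φ ψ : Module.End ℝ (ExteriorAlgebra A N)}
    (hφ : φ ∈ diffOpOrder A N k) (hψ : ψ ∈ diffOpOrder A N l) :
    φ * ψ ∈ diffOpOrder A N (k + l) := by
  induction hn : k + l generalizing k l φ ψ with
  | zero =>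
    obtain ⟨rfl, rfl⟩ : k = 0 ∧ l = 0 := by omega
    rw [mem_diffOpOrder_zero] at *
    intro i a ha
    rw [gradedComm_mul, hφ i a ha, hψ i a ha]; simp
  | succ n ih =>
    rw [mem_diffOpOrder_succ]
    intro i a ha
    rw [gradedComm_mul]
    refine add_mem ?_ ?_
    · cases k with
      | zero => rw [mem_diffOpOrder_zero.1 hφ i a ha, zero_mul]; exact zero_mem _
      | succ k => exact ih (mem_diffOpOrder_succ.1 hφ i a ha) hψ (by omega)
    · have hφ' := diffOpOrder_conj k i hφ
      cases l with
      | zero => rw [mem_diffOpOrder_zero.1 hψ i a ha, mul_zero]; exact zero_mem _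
      | succ l => exact ih hφ' (mem_diffOpOrder_succ.1 hψ i a ha) (by omega)

theorem mul_mem_diffOp {φ ψ : Module.End ℝ (ExteriorAlgebra A N)}
    (hφ : φ ∈ diffOp A N) (hψ : ψ ∈ diffOp A N) : φ * ψ ∈ diffOp A N := by
  rw [mem_diffOp] at *
  obtain ⟨k, hk⟩ := hφ
  obtain ⟨l, hl⟩ := hψ
  exact ⟨k + l, mul_mem_diffOpOrder hk hl⟩

/-- Graded commutativity of the exterior algebra. -/
theorem exterior_mul_comm {i : ℕ} {a : ExteriorAlgebra A N} (ha : a ∈ ⋀[A]^i N)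
    (b : ExteriorAlgebra A N) : a * b = (parity A N ^ i) b * a := by
  have h1 : ∀ (n : N) (b : ExteriorAlgebra A N),
      ExteriorAlgebra.ι A n * b = parity A N b * ExteriorAlgebra.ι A n := by
    intro n b
    induction b using ExteriorAlgebra.induction with
    | algebraMap r => simpa using (Algebra.commutes r _).symm
    | ι m =>
      rw [parity_apply]
      erw [CliffordAlgebra.involute_ι]
      rw [neg_mul]
      exact eq_neg_of_add_eq_zero_left (ExteriorAlgebra.ι_add_mul_swap n m)
    | mul b c hb hc =>
      rw [← mul_assoc, hb, mul_assoc, hc, parity_apply, parity_apply, parity_apply, map_mul,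
        mul_assoc]
    | add b c hb hc => rw [mul_add, hb, hc, map_add, add_mul]
  induction ha using Submodule.pow_induction_on_left' with
  | algebraMap r => simpa using Algebra.commutes r b
  | add x y i hx hy h1 h2 => rw [add_mul, h1, h2, mul_add]
  | mem_mul m hm i x hx h =>
    obtain ⟨n, rfl⟩ := hm
    rw [mul_assoc, h, ← mul_assoc]
    erw [h1]
    rw [mul_assoc, pow_succ']
    rfl

theorem mulLeft_mem_diffOpOrder (b : ExteriorAlgebra A N) :
    (LinearMap.mulLeft ℝ b : Module.End ℝ (ExteriorAlgebra A N)) ∈ diffOpOrder A N 0 := by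
  rw [mem_diffOpOrder_zero]
  intro i a ha
  change LinearMap.mulLeft ℝ a * LinearMap.mulLeft ℝ b -
    (parity A N ^ i * LinearMap.mulLeft ℝ b * parity A N ^ i) * LinearMap.mulLeft ℝ a = 0
  rw [parity_conj_mulLeft, sub_eq_zero]
  ext x
  simp only [Module.End.mul_apply, LinearMap.mulLeft_apply, ← mul_assoc]
  rw [exterior_mul_comm ha b]

/-- A derivation of degree zero is a differential operator of order one. -/
theorem extDer_mem_diffOpOrder {θ : Derivation ℝ A A} {δ : N →ₗ[ℝ] N} (hδ : IsSubordinate θ δ) :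
    extDer hδ ∈ diffOpOrder A N 1 := by
  have h1 : ∀ x, extDer hδ (parity A N x) = parity A N (extDer hδ x) := by
    intro x
    induction x using ExteriorAlgebra.induction with
    | algebraMap r => simp
    | ι m =>
      rw [extDer_ι, parity_apply, parity_apply]
      erw [CliffordAlgebra.involute_ι, CliffordAlgebra.involute_ι]
      rw [map_neg]
      erw [extDer_ι]
    | mul a b ha hb =>
      rw [parity_apply] at *
      rw [parity_apply] at *
      rw [extDer_mul, map_mul, extDer_mul, ha, hb]
      simp
    | add a b ha hb => rw [map_add, map_add, ha, hb, map_add, map_add]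
  have h2 : Commute (parity A N) (extDer hδ) := LinearMap.ext fun x => (h1 x).symm
  rw [mem_diffOpOrder_succ]
  intro i a ha
  have h3 : gradedComm A N i a (extDer hδ) = LinearMap.mulLeft ℝ (-(extDer hδ a)) := by
    change LinearMap.mulLeft ℝ a * extDer hδ - (parity A N ^ i * extDer hδ * parity A N ^ i) *
      LinearMap.mulLeft ℝ a = _
    rw [(h2.pow_left i).eq, mul_assoc (extDer hδ), parity_pow_mul_self, mul_one]
    ext x
    simp [extDer_mul]
  rw [h3]
  exact mulLeft_mem_diffOpOrder _

/-- An interior product is a differential operator of order one. -/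
theorem contract_mem_diffOpOrder (d : Module.Dual A N) :
    ((CliffordAlgebra.contractLeft (Q := (0 : QuadraticForm A N)) d).restrictScalars ℝ :
      Module.End ℝ (ExteriorAlgebra A N)) ∈ diffOpOrder A N 1 := by
  set c : ExteriorAlgebra A N →ₗ[A] ExteriorAlgebra A N :=
    CliffordAlgebra.contractLeft (Q := (0 : QuadraticForm A N)) d with hc
  have hι : ∀ (n : N) (b : ExteriorAlgebra A N), c (ExteriorAlgebra.ι A n * b) =
      d n • b - ExteriorAlgebra.ι A n * c b :=
    fun n b => CliffordAlgebra.contractLeft_ι_mul d n b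
  have hs : ∀ (r : A) (b : ExteriorAlgebra A N), c (algebraMap A _ r * b) =
      algebraMap A _ r * c b := fun r b => CliffordAlgebra.contractLeft_algebraMap_mul d r b
  have hr : ∀ (r : A), c (algebraMap A _ r) = 0 :=
    fun r => CliffordAlgebra.contractLeft_algebraMap _ d r
  have hpι : ∀ n : N, parity A N (ExteriorAlgebra.ι A n) = -ExteriorAlgebra.ι A n :=
    fun n => CliffordAlgebra.involute_ι n
  have hpm : ∀ x y : ExteriorAlgebra A N, parity A N (x * y) = parity A N x * parity A N y :=
    fun x y => by simp
  have hps : ∀ (r : A) (x : ExteriorAlgebra A N), parity A N (r • x) = r • parity A N x :=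
    fun r x => by simp
  have hpr : ∀ r : A, parity A N (algebraMap A _ r) = algebraMap A _ r := fun r => by simp
  have hmul : ∀ a b : ExteriorAlgebra A N, c (a * b) = c a * b + parity A N a * c b := by
    intro a b
    induction a using CliffordAlgebra.left_induction with
    | algebraMap r => 
      have := hs r b
      have h0 := hr r
      have h1 := hpr r
      erw [this, h0, h1]; simp
    | add x y hx hy => 
      rw [add_mul, map_add, hx, hy, map_add, map_add, add_mul, add_mul]; abel
    | ι_mul x n hx =>
      have h1 := hι n x
      have h2 := hι n (x * b)
      have h3 := hpι n
      have h4 := hpm (ExteriorAlgebra.ι A n) x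
      change c (ExteriorAlgebra.ι A n * x * b) = c (ExteriorAlgebra.ι A n * x) * b +
        parity A N (ExteriorAlgebra.ι A n * x) * c b
      rw [mul_assoc, h2, h1, h4, h3, hx, sub_mul, mul_add, smul_mul_assoc, neg_mul, neg_mul,
        mul_assoc, mul_assoc]
      abel
  have hpar : ∀ a, parity A N (c (parity A N a)) = - c a := by
    intro a
    induction a using CliffordAlgebra.left_induction with
    | algebraMap r =>
      have h0 := hr r
      have h1 := hpr r
      erw [h1, h0]; simp
    | add x y hx hy => rw [map_add, map_add, map_add, hx, hy, map_add]; abel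
    | ι_mul x n hx =>
      change parity A N (c (parity A N (ExteriorAlgebra.ι A n * x))) =
        -c (ExteriorAlgebra.ι A n * x)
      have h2 : parity A N (parity A N x) = x := by simp
      rw [hpm, hpι, neg_mul, map_neg, hι, map_neg, map_sub, hps, hpm, hpι, hx, hι, h2]
      simp
  rw [mem_diffOpOrder_succ]
  intro i a ha
  have hconj : parity A N ^ i * (c.restrictScalars ℝ : Module.End ℝ (ExteriorAlgebra A N)) *
      parity A N ^ i = (-1 : ℤˣ) ^ i • (c.restrictScalars ℝ) := by
    have h0 : parity A N * (c.restrictScalars ℝ : Module.End ℝ (ExteriorAlgebra A N)) *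
      parity A N = - c.restrictScalars ℝ := LinearMap.ext hpar
    clear ha
    induction i with
    | zero => simp
    | succ i ih =>
      have e : parity A N ^ (i + 1) = parity A N * parity A N ^ i := pow_succ' _ _
      have e' : parity A N ^ (i + 1) = parity A N ^ i * parity A N := pow_succ _ _
      rw [pow_succ' (-1 : ℤˣ), mul_smul, ← ih]
      calc _ = (parity A N * parity A N ^ i) * c.restrictScalars ℝ *
              (parity A N ^ i * parity A N) := by rw [← e, ← e']
        _ = parity A N * (parity A N ^ i * c.restrictScalars ℝ * parity A N ^ i)
              * parity A N := by simp only [mul_assoc]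
        _ = (-1 : ℤˣ) ^ i • (parity A N * c.restrictScalars ℝ * parity A N) := by
            rw [ih, Units.smul_def, Units.smul_def, mul_smul_comm, smul_mul_assoc]
        _ = _ := by rw [h0, ih]; simp
  have h3 : gradedComm A N i a (c.restrictScalars ℝ) =
      LinearMap.mulLeft ℝ (-((-1 : ℤˣ) ^ i • c a)) := by
    change LinearMap.mulLeft ℝ a * c.restrictScalars ℝ -
      (parity A N ^ i * c.restrictScalars ℝ * parity A N ^ i) * LinearMap.mulLeft ℝ a = _
    rw [hconj]
    ext x
    simp only [LinearMap.sub_apply, Module.End.mul_apply, LinearMap.mulLeft_apply,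
      LinearMap.coe_restrictScalars, LinearMap.smul_apply, hmul, parity_mem ha, smul_add,
      smul_mul_assoc, neg_mul]
    rw [smul_smul, ← pow_add,
      Even.neg_one_pow ⟨_, rfl⟩]
    simp
  rw [h3]
  exact mulLeft_mem_diffOpOrder _

/-- Restriction of operators to `A`. -/
def restrictFn : Module.End ℝ (ExteriorAlgebra A N) →ₗ[A] (A →ₗ[ℝ] ExteriorAlgebra A N) where
  toFun φ := φ ∘ₗ (Algebra.linearMap A (ExteriorAlgebra A N)).restrictScalars ℝ
  map_add' _ _ := rfl
  map_smul' _ _ := rfl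

theorem fnComm_restrictFn (a : A) (φ : Module.End ℝ (ExteriorAlgebra A N)) :
    fnComm A (ExteriorAlgebra A N) a (restrictFn φ) =
      restrictFn (gradedComm A N 0 (algebraMap A _ a) φ) := by
  ext f
  change a • φ (algebraMap A _ f) - φ (algebraMap A _ (a * f)) =
    algebraMap A _ a * φ (algebraMap A _ f) - φ (algebraMap A _ a * algebraMap A _ f)
  rw [map_mul, Algebra.smul_def]

theorem fnDiffOpOrder_le_succ (Q : Type*) [AddCommGroup Q] [Module A Q] [Module ℝ Q]
    [IsScalarTower ℝ A Q] (k : ℕ) : fnDiffOpOrder A Q k ≤ fnDiffOpOrder A Q (k + 1) := by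
  induction k with
  | zero => exact iInf_mono fun a => Submodule.comap_mono bot_le
  | succ k ih => exact iInf_mono fun a => Submodule.comap_mono ih

theorem mem_fnDiffOp {Q : Type*} [AddCommGroup Q] [Module A Q] [Module ℝ Q]
    [IsScalarTower ℝ A Q] {φ : A →ₗ[ℝ] Q} : φ ∈ fnDiffOp A Q ↔ ∃ k, φ ∈ fnDiffOpOrder A Q k :=
  Submodule.mem_iSup_of_directed _ (monotone_nat_of_le_succ (fnDiffOpOrder_le_succ Q)).directed_le

theorem restrictFn_mem_fnDiffOp {φ : Module.End ℝ (ExteriorAlgebra A N)} (h : φ ∈ diffOp A N) :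
    restrictFn φ ∈ fnDiffOp A (ExteriorAlgebra A N) := by
  rw [mem_diffOp] at h
  obtain ⟨k, hk⟩ := h
  rw [mem_fnDiffOp]
  refine ⟨k, ?_⟩
  have hA : ∀ a : A, algebraMap A (ExteriorAlgebra A N) a ∈ ⋀[A]^0 N := fun a => by
    change _ ∈ LinearMap.range (ExteriorAlgebra.ι A) ^ 0
    rw [pow_zero]; exact Submodule.mem_one.2 ⟨a, rfl⟩
  induction k generalizing φ with
  | zero =>
    rw [mem_diffOpOrder_zero] at hk
    simp only [fnDiffOpOrder, Submodule.mem_iInf, Submodule.mem_comap, Submodule.mem_bot]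
    intro a
    rw [fnComm_restrictFn, hk 0 _ (hA a), map_zero]
  | succ k ih =>
    rw [mem_diffOpOrder_succ] at hk
    simp only [fnDiffOpOrder, Submodule.mem_iInf, Submodule.mem_comap]
    intro a
    rw [fnComm_restrictFn]
    exact ih (hk 0 _ (hA a))

variable (A N) in
/-- Restriction of differential operators to `A`. -/
def restrictDiffOp : diffOp A N →ₗ[A] fnDiffOp A (ExteriorAlgebra A N) :=
  restrictFn.restrict fun _ h => restrictFn_mem_fnDiffOp h

end Graded
end DiffOp

section Foliation
variable (A : Type*) [CommRing A] [Algebra ℝ A]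

/-- Vector fields, as derivations of the algebra of functions. -/
abbrev VF := Derivation ℝ A A

/-- One-forms, as function-linear forms on vector fields. -/
abbrev OneForm := Module.Dual A (VF A)

/-- Linear connections in the tangent bundle. -/
structure LinearConnection where
  cov : VF A →ₗ[A] (VF A →ₗ[ℝ] VF A)
  leibniz : ∀ (X : VF A) (f : A) (Y : VF A), cov X (f • Y) = X f • Y + f • cov X Y

variable {A}

/-- The Lie derivative of a one-form. -/
def lieForm (X : VF A) (ω : OneForm A) : OneForm A where
  toFun Y := X (ω Y) - ω ⁅X, Y⁆
  map_add' Y Z := by simp; abel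
  map_smul' f Y := by
    have h : ⁅X, f • Y⁆ = X f • Y + f • ⁅X, Y⁆ := by
      ext g; simp [Derivation.commutator_apply]; ring
    simp [h]; ring

namespace LinearConnection

/-- The connection in the cotangent bundle. -/
def covForm (D : LinearConnection A) (X : VF A) : OneForm A →ₗ[ℝ] OneForm A where
  toFun ω :=
    { toFun := fun Y => X (ω Y) - ω (D.cov X Y)
      map_add' := fun Y Z => by simp; abel
      map_smul' := fun f Y => by simp [D.leibniz]; ring }
  map_add' ω η := by ext Y; simp; abel
  map_smul' c ω := by ext Y; simp [smul_sub]

theorem covForm_apply (D : LinearConnection A) (X : VF A) (ω : OneForm A) (Y : VF A) :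
    D.covForm X ω Y = X (ω Y) - ω (D.cov X Y) := rfl

def torsion (D : LinearConnection A) (X Y : VF A) : VF A := D.cov X Y - D.cov Y X - ⁅X, Y⁆

end LinearConnection

/-- `C` is involutive. -/
def IsInvolutive (C : Submodule A (VF A)) : Prop := ∀ X ∈ C, ∀ Y ∈ C, ⁅X, Y⁆ ∈ C

/-- Longitudinal one-forms: the quotient `Λ¹ / CΛ¹`, where `CΛ¹` is the annihilator of `C`. -/
abbrev BarForm (C : Submodule A (VF A)) := OneForm A ⧸ C.dualAnnihilator

/-- Longitudinal forms: the exterior algebra of the longitudinal one-forms. -/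
abbrev BarΛ (C : Submodule A (VF A)) := ExteriorAlgebra A (BarForm C)

/-- Connections adapted to the pair `(C, V)`.  A complementary distribution `V` identifies the
longitudinal one-forms `Λ¹ / CΛ¹` with the annihilator of `V`. -/
structure AdaptedConnection (C V : Submodule A (VF A)) extends LinearConnection A where
  restrict_bar : ∀ (X : VF A), ∀ ω ∈ V.dualAnnihilator,
    toLinearConnection.covForm X ω ∈ V.dualAnnihilator
  restrict_C : ∀ (X : VF A), ∀ ω ∈ C.dualAnnihilator,
    toLinearConnection.covForm X ω ∈ C.dualAnnihilator
  /-- `∇_Y ω` is the longitudinal part of `L_Y ω`. -/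
  cov_bar : ∀ Y ∈ V, ∀ ω ∈ V.dualAnnihilator,
    lieForm Y ω - toLinearConnection.covForm Y ω ∈ C.dualAnnihilator
  /-- `∇_X ω` is the component of `L_X ω` in the annihilator of `C`. -/
  cov_C : ∀ X ∈ C, ∀ ω ∈ C.dualAnnihilator,
    lieForm X ω - toLinearConnection.covForm X ω ∈ V.dualAnnihilator

namespace AdaptedConnection

variable {C V : Submodule A (VF A)}

/-- The torsion is `T(X, Y) = - [CX, CY]^V - [X^V, Y^V]^C`. -/
def IsTorsionQuasiFree (D : AdaptedConnection C V) (h : IsCompl C V) : Prop :=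
  ∀ X Y : VF A, D.torsion X Y =
    - V.projection C h.symm ⁅C.projection V h X, C.projection V h Y⁆
    - C.projection V h ⁅V.projection C h.symm X, V.projection C h.symm Y⁆

variable (D : AdaptedConnection C V)

/-- The covariant derivative of longitudinal one-forms. -/
def covBar (X : VF A) : BarForm C →ₗ[ℝ] BarForm C where
  toFun := Quotient.map' (D.covForm X) (fun ω η h => by
    rw [Submodule.quotientRel_def] at h ⊢
    rw [← map_sub]
    exact D.restrict_C X _ h)
  map_add' := by
    rintro ⟨ω⟩ ⟨η⟩
    exact congrArg (Submodule.Quotient.mk (p := C.dualAnnihilator)) (map_add (D.covForm X) ω η)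
  map_smul' := by
    rintro c ⟨ω⟩
    exact congrArg (Submodule.Quotient.mk (p := C.dualAnnihilator)) (map_smul (D.covForm X) c ω)

theorem covBar_mk (X : VF A) (ω : OneForm A) :
    D.covBar X (Submodule.Quotient.mk ω) = Submodule.Quotient.mk (D.covForm X ω) := rfl

theorem covBar_isSubordinate (X : VF A) : IsSubordinate X (D.covBar X) := by
  rintro a ⟨ω⟩
  refine congrArg (Submodule.Quotient.mk (p := C.dualAnnihilator))
    (show D.covForm X (a • ω) = X a • ω + a • D.covForm X ω from ?_)
  ext Y
  simp [LinearConnection.covForm_apply]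
  ring

/-- The covariant derivative `∇_X` of longitudinal forms: the degree zero derivation extending
`X` on functions and `∇_X` on longitudinal one-forms. -/
def nabla : VF A →ₗ[A] Module.End ℝ (BarΛ C) where
  toFun X := extDer (D.covBar_isSubordinate X)
  map_add' X Y := by
    ext x
    change extDer _ x = extDer _ x + extDer _ x
    induction x using ExteriorAlgebra.induction with
    | algebraMap r => simp
    | ι m =>
      obtain ⟨ω, rfl⟩ := Submodule.Quotient.mk_surjective _ m
      simp only [extDer_ι, covBar_mk, ← map_add, ← Submodule.Quotient.mk_add]
      congr 2
      ext Z; simp [LinearConnection.covForm_apply]; abel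
    | mul a b ha hb => simp only [extDer_mul, ha, hb, add_mul, mul_add]; abel
    | add a b ha hb => simp only [map_add, ha, hb]; abel
  map_smul' f X := by
    ext x
    change extDer _ x = f • extDer _ x
    induction x using ExteriorAlgebra.induction with
    | algebraMap r => simp [Algebra.smul_def]
    | ι m =>
      obtain ⟨ω, rfl⟩ := Submodule.Quotient.mk_surjective _ m
      simp only [extDer_ι, covBar_mk, ← map_smul, ← Submodule.Quotient.mk_smul]
      congr 2
      ext Z; simp [LinearConnection.covForm_apply]; ring
    | mul a b ha hb => simp only [extDer_mul, ha, hb, smul_add, smul_mul_assoc, mul_smul_comm]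
    | add a b ha hb => simp only [map_add, ha, hb, smul_add]

theorem cov_isSubordinate (X : VF A) : IsSubordinate X (D.cov X) := fun f Y => D.leibniz X f Y

/-- Composition with `∇_X`, as an operator on `Module.End ℝ Λ̄`. -/
def nablaComp (X : VF A) : Module.End ℝ (BarΛ C) →ₗ[ℝ] Module.End ℝ (BarΛ C) :=
  LinearMap.mulLeft ℝ (D.nabla X)

theorem nabla_smul (X : VF A) (a : A) (ω : BarΛ C) :
    D.nabla X (a • ω) = X a • ω + a • D.nabla X ω := by
  change extDer _ _ = _ + a • extDer _ _
  rw [Algebra.smul_def, extDer_mul, extDer_algebraMap, Algebra.smul_def, Algebra.smul_def]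

theorem nablaComp_isSubordinate (X : VF A) : IsSubordinate X (D.nablaComp X) := by
  intro a φ
  ext ω
  exact D.nabla_smul X a (φ ω)

/-- Iterated covariant derivatives of longitudinal forms:
`nablaIter k (X₁, …, Xₖ) ω = (∇ᵏ ω)(X₁, …, Xₖ)`, where
`(∇^{k+1} ω)(X₀, …, Xₖ) = ∇_{X₀}((∇ᵏ ω)(X₁, …, Xₖ)) - ∑ᵢ (∇ᵏ ω)(X₁, …, ∇_{X₀} Xᵢ, …, Xₖ)`. -/
def nablaIter : (k : ℕ) → MultilinearMap A (fun _ : Fin k => VF A) (Module.End ℝ (BarΛ C))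
  | 0 => MultilinearMap.constOfIsEmpty A _ 1
  | k + 1 => LinearMap.uncurryLeft
    { toFun := fun X => covStep (D.nablaComp_isSubordinate X) (D.cov_isSubordinate X) (nablaIter k)
      map_add' := fun X Y => by
        ext v ω
        simp [covStep, nablaComp, Finset.sum_add_distrib]
        abel
      map_smul' := fun f X => by
        ext v ω
        simp [covStep, nablaComp, smul_sub, Finset.smul_sum] }

/-- `∇_P` for a symmetric contravariant tensor `P`: the contraction
`P^{a₁⋯aₖ} ∇_{a₁} ⋯ ∇_{aₖ}` of `P` with the iterated covariant derivative. -/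
def nablaSym : SymmetricAlgebra A (VF A) →ₗ[A] Module.End ℝ (BarΛ C) := symLift D.nablaIter

end AdaptedConnection

end Foliation

section PBW
variable {A : Type*} [CommRing A] [Algebra ℝ A] (C V : Submodule A (VF A))

section Normal
variable (Q : Type*) [AddCommGroup Q] [Module A Q] [Module ℝ Q] [IsScalarTower ℝ A Q]

/-- The submodule `𝒟(A, Q) ∘ C` of `𝒟(A, Q)`. -/
def compC : Submodule A (fnDiffOp A Q) :=
  Submodule.span A {ψ | ∃ φ : fnDiffOp A Q, ∃ X ∈ C,
    (ψ : A →ₗ[ℝ] Q) = (φ : A →ₗ[ℝ] Q) ∘ₗ (X : A →ₗ[ℝ] A)}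

/-- Normal differential operators with values in `Q`: the quotient of `𝒟(A, Q)` by
`𝒟(A, Q) ∘ C`, canonically isomorphic to `Q ⊗ 𝒟̄`. -/
abbrev NormalOp : Type _ := fnDiffOp A Q ⧸ compC C Q

/-- The class of an operator. -/
def normalClass : fnDiffOp A Q →ₗ[A] NormalOp C Q := (compC C Q).mkQ

end Normal

/-- The canonical projection `p : 𝒟(Λ̄) → Λ̄ ⊗ 𝒟̄`: restrict an operator to functions and take the
class of the result. -/
def canProj : diffOp A (BarForm C) →ₗ[A] NormalOp C (BarΛ C) :=
  normalClass C (BarΛ C) ∘ₗ restrictDiffOp A (BarForm C)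

/-- The pairing of longitudinal one-forms with vector fields in `C`. -/
def pairing : C →ₗ[A] Module.Dual A (BarForm C) where
  toFun X := C.dualAnnihilator.liftQ (Module.Dual.eval A (VF A) X) fun ω hω =>
    (Submodule.mem_dualAnnihilator ω).1 hω X X.2
  map_add' X Y := by
    refine Submodule.linearMap_qext _ (LinearMap.ext fun ω => ?_)
    exact map_add ω (X : VF A) Y
  map_smul' f X := by
    refine Submodule.linearMap_qext _ (LinearMap.ext fun ω => ?_)
    exact map_smul ω f (X : VF A)

/-- `X₁ ∧ ⋯ ∧ Xₖ ↦ i_{X₁} ⋯ i_{Xₖ}`. -/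
def interior : ExteriorAlgebra A C →ₐ[A] Module.End A (BarΛ C) :=
  ExteriorAlgebra.lift A
    ⟨CliffordAlgebra.contractLeft (Q := (0 : QuadraticForm A (BarForm C))) ∘ₗ pairing C,
      fun X => LinearMap.ext fun ω => CliffordAlgebra.contractLeft_contractLeft (pairing C X) ω⟩

/-- The algebra of symbols `𝒮(Λ̄) = Λ̄ ⊗ Λ^•C ⊗ S^•C ⊗ S^•V`. -/
abbrev Symb := BarΛ C ⊗[A] (ExteriorAlgebra A C ⊗[A] (SymmetricAlgebra A C ⊗[A] SymmetricAlgebra A V))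

/-- The algebra `Λ̄ ⊗ S^•V`. -/
abbrev NormalSymb := BarΛ C ⊗[A] SymmetricAlgebra A V

/-- The `k`-th symmetric power. -/
def symPow (X : Type*) [AddCommGroup X] [Module A X] (k : ℕ) : Submodule A (SymmetricAlgebra A X) :=
  LinearMap.range (SymmetricAlgebra.ι A X) ^ k

/-- The submodule `𝒮_H` of symbols of order `H`. -/
def symbOrder (H : ℕ) : Submodule A (Symb C V) :=
  Submodule.span A {s | ∃ k l m : ℕ, k + l + m = H ∧ ∃ ω : BarΛ C, ∃ x ∈ ⋀[A]^k C,
    ∃ P ∈ symPow C l, ∃ Q ∈ symPow V m, s = ω ⊗ₜ[A] (x ⊗ₜ[A] (P ⊗ₜ[A] Q))}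

/-- The submodule `Λ̄ ⊗ S^kV`. -/
def normalSymbOrder (k : ℕ) : Submodule A (NormalSymb C V) :=
  Submodule.span A {s | ∃ ω : BarΛ C, ∃ Q ∈ symPow V k, s = ω ⊗ₜ[A] Q}

/-- The projection `p₀ : 𝒮(Λ̄) → Λ̄ ⊗ S^•V` of symbols onto the component without factors from
`C`. -/
def symbProj : Symb C V →ₗ[A] NormalSymb C V :=
  TensorProduct.map LinearMap.id
    ((TensorProduct.lid A _).toLinearMap ∘ₗ TensorProduct.map
      (ExteriorAlgebra.algebraMapInv (R := A) (M := C)).toLinearMap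
      ((TensorProduct.lid A _).toLinearMap ∘ₗ TensorProduct.map
        (SymmetricAlgebra.algebraMapInv (R := A) (M := C)).toLinearMap LinearMap.id))

/-- `P ⊗ Q ↦ P ⊙ Q`. -/
def symMul : SymmetricAlgebra A C ⊗[A] SymmetricAlgebra A V →ₗ[A] SymmetricAlgebra A (VF A) :=
  LinearMap.mul' A _ ∘ₗ TensorProduct.map
    (SymmetricAlgebra.lift (SymmetricAlgebra.ι A (VF A) ∘ₗ C.subtype)).toLinearMap
    (SymmetricAlgebra.lift (SymmetricAlgebra.ι A (VF A) ∘ₗ V.subtype)).toLinearMap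

namespace AdaptedConnection

variable {C V}
variable (D : AdaptedConnection C V)

theorem nablaIter_mem (k : ℕ) (v : Fin k → VF A) : D.nablaIter k v ∈ diffOp A (BarForm C) := by
  induction k with
  | zero =>
    refine mem_diffOp.2 ⟨0, ?_⟩
    have : D.nablaIter 0 v = LinearMap.mulLeft ℝ (1 : BarΛ C) := by
      rw [LinearMap.mulLeft_one]; rfl
    rw [this]
    exact mulLeft_mem_diffOpOrder _
  | succ k ih =>
    change D.nabla (v 0) * D.nablaIter k (Fin.tail v) - ∑ i, D.nablaIter k _ ∈ _
    exact sub_mem (mul_mem_diffOp (mem_diffOp.2 ⟨1, extDer_mem_diffOpOrder _⟩) (ih _))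
      (sum_mem fun i _ => ih _)

theorem nablaSym_mem (P : SymmetricAlgebra A (VF A)) : D.nablaSym P ∈ diffOp A (BarForm C) :=
  symLift_mem _ _ D.nablaIter_mem P

end AdaptedConnection

theorem interior_mem (x : ExteriorAlgebra A C) :
    ((interior C x).restrictScalars ℝ : Module.End ℝ (BarΛ C)) ∈ diffOp A (BarForm C) := by
  induction x using ExteriorAlgebra.induction with
  | algebraMap r =>
    rw [AlgHom.commutes]
    refine mem_diffOp.2 ⟨0, ?_⟩
    convert! mulLeft_mem_diffOpOrder (N := BarForm C) (algebraMap A (BarΛ C) r) using 1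
  | ι X =>
    refine mem_diffOp.2 ⟨1, ?_⟩
    rw [interior, ExteriorAlgebra.lift_ι_apply]
    exact contract_mem_diffOpOrder _
  | mul a b ha hb => rw [map_mul]; exact mul_mem_diffOp ha hb
  | add a b ha hb => rw [map_add]; exact add_mem ha hb

/-- `ω ⊗ φ ↦ ω φ`. -/
def formMul : BarΛ C →ₗ[A] Module.End ℝ (BarΛ C) →ₗ[A] Module.End ℝ (BarΛ C) :=
  LinearMap.mk₂ A (fun ω φ => LinearMap.mulLeft ℝ ω ∘ₗ φ)
    (fun _ _ _ => by ext; simp [add_mul]) (fun _ _ _ => by ext; simp)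
    (fun _ _ _ => by ext; simp [mul_add]) (fun _ _ _ => by ext; simp)

/-- `x ⊗ φ ↦ i_x φ`. -/
def interiorMul :
    ExteriorAlgebra A C →ₗ[A] Module.End ℝ (BarΛ C) →ₗ[A] Module.End ℝ (BarΛ C) :=
  LinearMap.mk₂ A (fun x φ => (interior C x).restrictScalars ℝ ∘ₗ φ)
    (fun _ _ _ => by ext; simp) (fun _ _ _ => by ext; simp)
    (fun _ _ _ => by ext; simp) (fun _ _ _ => by ext; simp)

namespace AdaptedConnection

variable {C V}
variable (D : AdaptedConnection C V)

def pbwEnd : Symb C V →ₗ[A] Module.End ℝ (BarΛ C) :=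
  TensorProduct.lift ((formMul C).compl₂
    (TensorProduct.lift ((interiorMul C).compl₂ (D.nablaSym ∘ₗ symMul C V))))

theorem pbwEnd_tmul (ω : BarΛ C) (x : ExteriorAlgebra A C) (P : SymmetricAlgebra A C)
    (Q : SymmetricAlgebra A V) : D.pbwEnd (ω ⊗ₜ (x ⊗ₜ (P ⊗ₜ Q))) =
      LinearMap.mulLeft ℝ ω * ((interior C x).restrictScalars ℝ *
        D.nablaSym (symMul C V (P ⊗ₜ Q))) := rfl

theorem pbwEnd_mem (s : Symb C V) : D.pbwEnd s ∈ diffOp A (BarForm C) := by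
  induction s using TensorProduct.induction_on with
  | zero => simp
  | add x y hx hy => rw [map_add]; exact add_mem hx hy
  | tmul ω t =>
    refine mul_mem_diffOp (mem_diffOp.2 ⟨0, mulLeft_mem_diffOpOrder ω⟩) ?_
    induction t using TensorProduct.induction_on with
    | zero => rw [map_zero]; exact zero_mem _
    | add x y hx hy => rw [map_add]; exact add_mem hx hy
    | tmul x u => exact mul_mem_diffOp (interior_mem C x) (D.nablaSym_mem _)

/-- `PBW : 𝒮(Λ̄) → 𝒟(Λ̄)`, `ω ⊗ X₁ ∧ ⋯ ∧ Xₖ ⊗ P ⊗ Q ↦ ω i_{X₁} ⋯ i_{Xₖ} ∇_{P ⊙ Q}`. -/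
def pbw : Symb C V →ₗ[A] diffOp A (BarForm C) := D.pbwEnd.codRestrict _ D.pbwEnd_mem

def pbwBarEnd : NormalSymb C V →ₗ[A] Module.End ℝ (BarΛ C) :=
  TensorProduct.lift ((formMul C).compl₂ (D.nablaSym ∘ₗ
    (SymmetricAlgebra.lift (SymmetricAlgebra.ι A (VF A) ∘ₗ V.subtype)).toLinearMap))

theorem pbwBarEnd_mem (s : NormalSymb C V) : D.pbwBarEnd s ∈ diffOp A (BarForm C) := by
  induction s using TensorProduct.induction_on with
  | zero => simp
  | add x y hx hy => rw [map_add]; exact add_mem hx hy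
  | tmul ω t =>
    exact mul_mem_diffOp (mem_diffOp.2 ⟨0, mulLeft_mem_diffOpOrder ω⟩) (D.nablaSym_mem _)

/-- `PBW : Λ̄ ⊗ S^•V → Λ̄ ⊗ 𝒟̄`, which maps `ω ⊗ P` to the class of `f ↦ ω ∇_P f`. -/
def pbwBar : NormalSymb C V →ₗ[A] NormalOp C (BarΛ C) :=
  normalClass C (BarΛ C) ∘ₗ restrictDiffOp A (BarForm C) ∘ₗ
    D.pbwBarEnd.codRestrict _ D.pbwBarEnd_mem

end AdaptedConnection
end PBW

section Order
variable {A : Type*} [CommRing A] [Algebra ℝ A] {C V : Submodule A (VF A)}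

namespace AdaptedConnection

variable (D : AdaptedConnection C V)

/-- The submodule of `Λ̄ ⊗ 𝒟̄` of the elements of order no higher than `k`, where the elements of
order `j` are the images of `Λ̄ ⊗ S^jV` under the map `PBW`. -/
def orderLE (k : ℤ) : Submodule A (NormalOp C (BarΛ C)) :=
  ⨆ (j : ℕ) (_ : (j : ℤ) ≤ k), (normalSymbOrder C V j).map D.pbwBar

/-- The family `τ` is the expansion, with respect to the order, of the image under the projection
`p` of the operator `PBW s` of order `H`: `τ i`, an element of `Λ̄ ⊗ S^{H+i}V`, corresponds to
`p^{[i]} (PBW s)` under the map `PBW : Λ̄ ⊗ S^•V → Λ̄ ⊗ 𝒟̄`. -/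
structure IsOrderExpansion (H : ℕ) (s : Symb C V) (τ : ℤ →₀ NormalSymb C V) : Prop where
  mem : ∀ (i : ℤ) (k : ℕ), (k : ℤ) = H + i → τ i ∈ normalSymbOrder C V k
  eq_zero : ∀ i : ℤ, H + i < 0 → τ i = 0
  sum_eq : canProj C (D.pbw s) = D.pbwBar (τ.sum fun _ t => t)

end AdaptedConnection
end Order

section Manifold
open scoped Manifold ContDiff Topology

/-- A smooth distribution of rank `n` on a manifold: a subspace of each tangent space, locally
spanned by `n` pointwise linearly independent vector fields.  Tangent vectors and vector fields are
derivations of the algebra of smooth functions. -/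
structure Distribution (d : ℕ) (M : Type*) [TopologicalSpace M]
    [ChartedSpace (EuclideanSpace ℝ (Fin d)) M] (n : ℕ) where
  fiber : ∀ x : M, Submodule ℝ (PointDerivation (𝓡 d) x)
  exists_frame : ∀ x : M, ∃ X : Fin n → VF C^∞⟮𝓡 d, M; ℝ⟯, ∀ᶠ y in 𝓝 x,
    LinearIndependent ℝ (fun i => Derivation.evalAt y (X i)) ∧
      Submodule.span ℝ (Set.range fun i => Derivation.evalAt y (X i)) = fiber y

/-- The module of vector fields tangent to a distribution. -/
def Distribution.sections {d : ℕ} {M : Type*} [TopologicalSpace M]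
    [ChartedSpace (EuclideanSpace ℝ (Fin d)) M] {n : ℕ} (C : Distribution d M n) :
    Submodule C^∞⟮𝓡 d, M; ℝ⟯ (VF C^∞⟮𝓡 d, M; ℝ⟯) where
  carrier := {X | ∀ x, Derivation.evalAt x X ∈ C.fiber x}
  zero_mem' x := by rw [map_zero]; exact zero_mem _
  add_mem' hX hY x := by rw [map_add]; exact add_mem (hX x) (hY x)
  smul_mem' f X hX x := (C.fiber x).smul_mem (f x) (hX x)

end Manifold

end FolPBW

end


open scoped Manifold ContDiff

/-!
# The projection onto normal differential operators, up to order two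

All arguments are algebraic: `A` is a commutative real algebra with `Der A = C ⊕ V`, and
`u_k(X₁, …, X_k) : A → A` denotes the operator `f ↦ (∇ᵏ f)(X₁, …, X_k)` (`scalarIter`).
Covariant derivatives of functions are functions, so interior products annihilate them, and on a
decomposable symbol `η ⊗ x ⊗ P ⊗ Q` the projection `p` depends only on the class, modulo the left
ideal `𝒟(A) ∘ C`, of the scalar operator `∇_{P ⊙ Q}`.  It has to be shown that this class has order
at most `H - 2` as soon as `P` has positive degree.

The key fact is `scalarIter_mem_of_mem`: if some `X_i` lies in `C`, then `u_k(X₁, …, X_k)` belongs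
to `𝒟(A) ∘ C` plus the span of the `u_j` with `j ≤ k - 2`.  Indeed `∇` preserves `C`
(`cov_mem_left`), so an argument from `C` in the innermost place yields an element of the ideal.
It can be moved to the innermost place by interchanging neighbours.  An interchange costs a torsion
term, of order lower by one, and curvature terms, of order lower by two
(`scalarIter_swap_mem`); the torsion term is absent because the torsion of a torsion-quasi-free
connection vanishes when one of its arguments lies in the involutive distribution `C`
(`torsion_eq_zero`).

It remains to see that every `u_j`, modulo the ideal, has order at most `j` in the sense of the map
`PBW` (`scalarIter_mem_scalarOrderLE`).  After splitting the arguments into their parts in `C` and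
`V`, the key fact disposes of the terms with an argument from `C`, and the remaining term agrees
with its symmetrization up to operators of lower order, since derivations commute up to their Lie
bracket.
-/

namespace FolPBW

noncomputable section

variable {A : Type*} [CommRing A] [Algebra ℝ A] {C V : Submodule A (VF A)}

/-! ### Parallel distributions and torsion -/

/-- Evaluation of vector fields at a function `f`, that is, the one-form `df`. -/
def differential (f : A) : OneForm A where
  toFun X := X f
  map_add' _ _ := rfl
  map_smul' _ _ := rfl

/-- A distribution with a complement is the common kernel of the one-forms annihilating it: if `π`
is the projection with kernel `V`, the forms `df ∘ π` suffice, as a derivation is determined by its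
values on functions. -/
theorem mem_of_forall_annihilator (h : IsCompl V C) {Z : VF A}
    (hZ : ∀ η ∈ V.dualAnnihilator, η Z = 0) : Z ∈ V := by
  rw [← Submodule.projection_apply_eq_zero_iff h.symm]
  refine Derivation.ext fun f => ?_
  refine hZ (differential f ∘ₗ C.projection V h.symm) ?_
  rw [Submodule.mem_dualAnnihilator]
  intro Y hY
  rw [LinearMap.comp_apply, (Submodule.projection_apply_eq_zero_iff h.symm).2 hY, map_zero]

namespace AdaptedConnection

variable (D : AdaptedConnection C V)

theorem cov_mem_left (h : IsCompl C V) (X : VF A) {Y : VF A} (hY : Y ∈ C) : D.cov X Y ∈ C := by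
  refine mem_of_forall_annihilator h fun η hη => ?_
  have h1 := (Submodule.mem_dualAnnihilator _).1 (D.restrict_C X η hη) Y hY
  rw [LinearConnection.covForm_apply, (Submodule.mem_dualAnnihilator _).1 hη Y hY, map_zero,
    zero_sub, neg_eq_zero] at h1
  exact h1

variable {D}

/-- For involutive `C` the torsion of a torsion-quasi-free connection vanishes as soon as one of
its arguments is tangent to `C`. -/
theorem IsTorsionQuasiFree.torsion_eq_zero {h : IsCompl C V} (hD : D.IsTorsionQuasiFree h)
    (hC : IsInvolutive C) {X : VF A} (hX : X ∈ C) (Y : VF A) : D.torsion X Y = 0 := by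
  have h1 : V.projection C h.symm X = 0 := (Submodule.projection_apply_eq_zero_iff h.symm).2 hX
  have h2 : V.projection C h.symm ⁅C.projection V h X, C.projection V h Y⁆ = 0 :=
    (Submodule.projection_apply_eq_zero_iff h.symm).2
      (hC _ (Submodule.projection_apply_mem h X) _ (Submodule.projection_apply_mem h Y))
  rw [hD X Y, h2, h1, zero_lie, map_zero, neg_zero, sub_zero]

end AdaptedConnection

/-! ### Iterated covariant derivatives of functions -/

/-- Composition with `X` on the left, as an operator on operators on functions. -/
def vfComp (X : VF A) (φ : Module.End ℝ A) : Module.End ℝ A := (X : A →ₗ[ℝ] A) * φ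

theorem vfComp_apply (X : VF A) (φ : Module.End ℝ A) (f : A) : vfComp X φ f = X (φ f) := rfl

theorem vfComp_zero (X : VF A) : vfComp X 0 = 0 := mul_zero _

theorem vfComp_add (X : VF A) (φ ψ : Module.End ℝ A) :
    vfComp X (φ + ψ) = vfComp X φ + vfComp X ψ := mul_add _ _ _

theorem vfComp_sub (X : VF A) (φ ψ : Module.End ℝ A) :
    vfComp X (φ - ψ) = vfComp X φ - vfComp X ψ := mul_sub _ _ _

theorem vfComp_sum {ι : Type*} (X : VF A) (s : Finset ι) (φ : ι → Module.End ℝ A) :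
    vfComp X (∑ i ∈ s, φ i) = ∑ i ∈ s, vfComp X (φ i) := Finset.mul_sum _ _ _

theorem vfComp_smul (X : VF A) (a : A) (φ : Module.End ℝ A) :
    vfComp X (a • φ) = X a • φ + a • vfComp X φ := by
  ext f
  simp only [vfComp_apply, LinearMap.add_apply, LinearMap.smul_apply, smul_eq_mul,
    Derivation.leibniz]
  ring

/-- The degree zero component of the restriction to functions of an operator on longitudinal
forms. -/
def scalarPart (C : Submodule A (VF A)) : Module.End ℝ (BarΛ C) →ₗ[A] Module.End ℝ A where
  toFun φ := (ExteriorAlgebra.algebraMapInv (R := A) (M := BarForm C)).toLinearMap.restrictScalars ℝ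
    ∘ₗ φ ∘ₗ (Algebra.linearMap A (BarΛ C)).restrictScalars ℝ
  map_add' φ ψ := by ext; simp
  map_smul' a φ := by ext; simp

namespace AdaptedConnection

variable (D : AdaptedConnection C V)

theorem algebraMapInv_nabla (X : VF A) (η : BarΛ C) :
    ExteriorAlgebra.algebraMapInv (D.nabla X η) = X (ExteriorAlgebra.algebraMapInv η) := by
  change ExteriorAlgebra.algebraMapInv (extDer (D.covBar_isSubordinate X) η) = _
  have hι : ∀ m : BarForm C, ExteriorAlgebra.algebraMapInv (ExteriorAlgebra.ι A m) = 0 :=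
    fun m => ExteriorAlgebra.lift_ι_apply _ _ _ _
  induction η using ExteriorAlgebra.induction with
  | algebraMap r => rw [extDer_algebraMap, ExteriorAlgebra.algebraMap_leftInverse,
      ExteriorAlgebra.algebraMap_leftInverse]
  | ι m => rw [extDer_ι, hι, hι, map_zero]
  | mul a b ha hb =>
    rw [extDer_mul, map_add, map_mul, map_mul, map_mul, ha, hb, Derivation.leibniz, smul_eq_mul,
      smul_eq_mul]
    ring
  | add a b ha hb => rw [map_add, map_add, map_add, map_add, ha, hb]

/-- The iterated covariant derivative of functions, `scalarIter k (X₁, …, Xₖ) f =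
(∇ᵏ f)(X₁, …, Xₖ)`. -/
def scalarIter (k : ℕ) : MultilinearMap A (fun _ : Fin k => VF A) (Module.End ℝ A) :=
  (scalarPart C).compMultilinearMap (D.nablaIter k)

theorem scalarIter_zero (v : Fin 0 → VF A) : D.scalarIter 0 v = 1 := by
  ext f
  exact ExteriorAlgebra.algebraMap_leftInverse _ f

theorem nablaIter_cons (k : ℕ) (X : VF A) (v : Fin k → VF A) :
    D.nablaIter (k + 1) (Fin.cons X v) = D.nabla X * D.nablaIter k v -
      ∑ i, D.nablaIter k (Function.update v i (D.cov X (v i))) := rfl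

theorem scalarIter_cons (k : ℕ) (X : VF A) (v : Fin k → VF A) :
    D.scalarIter (k + 1) (Fin.cons X v) = vfComp X (D.scalarIter k v) -
      ∑ i, D.scalarIter k (Function.update v i (D.cov X (v i))) := by
  simp only [scalarIter, LinearMap.compMultilinearMap_apply, nablaIter_cons, map_sub, map_sum]
  congr 1
  ext f
  exact D.algebraMapInv_nabla X _

/-- Covariant derivatives of functions are functions. -/
theorem nablaIter_algebraMap (k : ℕ) (v : Fin k → VF A) (f : A) :
    D.nablaIter k v (algebraMap A _ f) = algebraMap A _ (D.scalarIter k v f) := by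
  induction k with
  | zero => rw [scalarIter_zero]; rfl
  | succ k ih =>
    rw [← Fin.cons_self_tail v, scalarIter_cons, nablaIter_cons]
    simp only [LinearMap.sub_apply, LinearMap.sum_apply, Module.End.mul_apply, ih, map_sub,
      map_sum, vfComp_apply]
    congr 1
    exact extDer_algebraMap _ _

/-- The operators `f ↦ (∇ʲ f)(X₁, …, Xⱼ)` with `j < n` span the module of operators of order less
than `n`. -/
def scalarLT (n : ℕ) : Submodule A (Module.End ℝ A) :=
  Submodule.span A {φ | ∃ j < n, ∃ v, φ = D.scalarIter j v}

theorem scalarIter_mem_scalarLT {j n : ℕ} (h : j < n) (v : Fin j → VF A) :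
    D.scalarIter j v ∈ D.scalarLT n := Submodule.subset_span ⟨j, h, v, rfl⟩

theorem scalarLT_mono {m n : ℕ} (h : m ≤ n) : D.scalarLT m ≤ D.scalarLT n :=
  Submodule.span_mono fun _ ⟨j, hj, hv⟩ => ⟨j, hj.trans_le h, hv⟩

theorem vfComp_mem_scalarLT (X : VF A) {n : ℕ} {φ : Module.End ℝ A} (h : φ ∈ D.scalarLT n) :
    vfComp X φ ∈ D.scalarLT (n + 1) := by
  induction h using Submodule.span_induction with
  | zero => rw [vfComp_zero]; exact zero_mem _
  | add φ ψ _ _ h h' => rw [vfComp_add]; exact add_mem h h'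
  | smul a φ hφ h =>
    rw [vfComp_smul]
    exact add_mem (Submodule.smul_mem _ _ (D.scalarLT_mono n.le_succ hφ))
      (Submodule.smul_mem _ _ h)
  | mem φ hφ =>
    obtain ⟨j, hj, v, rfl⟩ := hφ
    rw [sub_eq_iff_eq_add.1 (D.scalarIter_cons j X v).symm]
    exact add_mem (D.scalarIter_mem_scalarLT (by omega) _)
      (sum_mem fun i _ => D.scalarIter_mem_scalarLT (by omega) _)

/-- The two outermost covariant derivatives of a function, written out up to terms of lower order.
The sum is symmetric in `X` and `Y`, and only the first two terms contribute to the commutator. -/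
theorem scalarIter_cons_cons (k : ℕ) (X Y : VF A) (v : Fin k → VF A) :
    D.scalarIter (k + 2) (Fin.cons X (Fin.cons Y v)) -
      (vfComp X (vfComp Y (D.scalarIter k v)) - vfComp (D.cov X Y) (D.scalarIter k v)
        - ∑ i, (vfComp X (D.scalarIter k (Function.update v i (D.cov Y (v i)))) +
          vfComp Y (D.scalarIter k (Function.update v i (D.cov X (v i))))))
      ∈ D.scalarLT (k + 1) := by
  rw [scalarIter_cons, Fin.sum_univ_succ]
  simp only [Fin.cons_zero, Fin.cons_succ, Fin.update_cons_zero, ← Fin.cons_update,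
    scalarIter_cons, vfComp_sub, vfComp_sum, Finset.sum_sub_distrib, Finset.sum_add_distrib]
  convert_to (∑ i, D.scalarIter k (Function.update v i (D.cov (D.cov X Y) (v i)))) +
    ∑ i, ∑ j, D.scalarIter k (Function.update (Function.update v i (D.cov X (v i))) j
      (D.cov Y (Function.update v i (D.cov X (v i)) j))) ∈ _
  · abel
  · exact add_mem (sum_mem fun i _ => D.scalarIter_mem_scalarLT (by omega) _)
      (sum_mem fun i _ => sum_mem fun j _ => D.scalarIter_mem_scalarLT (by omega) _)

/-- Without torsion, the two outermost covariant derivatives of a function commute up to curvature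
terms, which are of order lower by two. -/
theorem scalarIter_swap_mem {X Y : VF A} (h : D.torsion X Y = 0) (k : ℕ) (v : Fin k → VF A) :
    D.scalarIter (k + 2) (Fin.cons X (Fin.cons Y v)) -
      D.scalarIter (k + 2) (Fin.cons Y (Fin.cons X v)) ∈ D.scalarLT (k + 1) := by
  have hs := sub_mem (D.scalarIter_cons_cons k X Y v) (D.scalarIter_cons_cons k Y X v)
  have e : vfComp X (vfComp Y (D.scalarIter k v)) - vfComp (D.cov X Y) (D.scalarIter k v) =
      vfComp Y (vfComp X (D.scalarIter k v)) - vfComp (D.cov Y X) (D.scalarIter k v) := by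
    ext f
    have hf := congrArg (fun Z : VF A => Z (D.scalarIter k v f)) h
    simp only [LinearConnection.torsion, Derivation.sub_apply, Derivation.commutator_apply,
      Derivation.zero_apply] at hf
    simp only [LinearMap.sub_apply, vfComp_apply]
    linear_combination -hf
  rw [e] at hs
  simp only [Finset.sum_add_distrib] at hs
  convert hs using 1
  abel

end AdaptedConnection

/-! ### The left ideal generated by `C` -/

variable (C) in
/-- The left ideal `𝒟(A) ∘ C` of the algebra of scalar differential operators. -/
def scalarIdeal : Submodule A (Module.End ℝ A) :=
  Submodule.span A {ψ | ∃ φ ∈ fnDiffOp A A, ∃ X ∈ C, ψ = φ ∘ₗ (X : A →ₗ[ℝ] A)}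

theorem vfComp_mem_fnDiffOp (X : VF A) {φ : Module.End ℝ A} (h : φ ∈ fnDiffOp A A) :
    vfComp X φ ∈ fnDiffOp A A := by
  rw [mem_fnDiffOp] at h ⊢
  obtain ⟨k, hk⟩ := h
  have e : ∀ (a : A) (φ : Module.End ℝ A), fnComm A A a (vfComp X φ) =
      vfComp X (fnComm A A a φ) - X a • φ := by
    intro a φ
    ext f
    change a * X (φ f) - X (φ (a * f)) = X (a * φ f - φ (a * f)) - X a * φ f
    rw [map_sub, Derivation.leibniz, smul_eq_mul, smul_eq_mul]
    ring
  refine ⟨k + 1, ?_⟩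
  induction k generalizing φ with
  | zero =>
    simp only [fnDiffOpOrder, Submodule.mem_iInf, Submodule.mem_comap, Submodule.mem_bot] at hk ⊢
    intro a b
    rw [e, hk a, vfComp_zero, zero_sub, map_neg, map_smul, hk b, smul_zero, neg_zero]
  | succ k ih =>
    have hk' := hk
    simp only [fnDiffOpOrder, Submodule.mem_iInf, Submodule.mem_comap] at hk'
    rw [fnDiffOpOrder]
    simp only [Submodule.mem_iInf, Submodule.mem_comap]
    intro a
    rw [e]
    exact sub_mem (ih (hk' a)) (Submodule.smul_mem _ _ hk)

theorem one_mem_fnDiffOp : (1 : Module.End ℝ A) ∈ fnDiffOp A A := by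
  rw [mem_fnDiffOp]
  refine ⟨0, ?_⟩
  simp only [fnDiffOpOrder, Submodule.mem_iInf, Submodule.mem_comap, Submodule.mem_bot]
  intro a
  ext f
  exact sub_self (a * f)

theorem coe_mem_scalarIdeal {X : VF A} (hX : X ∈ C) :
    ((X : A →ₗ[ℝ] A) : Module.End ℝ A) ∈ scalarIdeal C :=
  Submodule.subset_span ⟨1, one_mem_fnDiffOp, X, hX, rfl⟩

theorem vfComp_mem_scalarIdeal (X : VF A) {ψ : Module.End ℝ A} (h : ψ ∈ scalarIdeal C) :
    vfComp X ψ ∈ scalarIdeal C := by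
  induction h using Submodule.span_induction with
  | zero => rw [vfComp_zero]; exact zero_mem _
  | add φ ψ _ _ h h' => rw [vfComp_add]; exact add_mem h h'
  | smul a φ hφ h =>
    rw [vfComp_smul]
    exact add_mem (Submodule.smul_mem _ _ hφ) (Submodule.smul_mem _ _ h)
  | mem ψ hψ =>
    obtain ⟨φ, hφ, Y, hY, rfl⟩ := hψ
    exact Submodule.subset_span ⟨vfComp X φ, vfComp_mem_fnDiffOp X hφ, Y, hY, rfl⟩

namespace AdaptedConnection

variable (D : AdaptedConnection C V)

/-- The key step: an iterated covariant derivative of a function with an argument in `C` is, up to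
the ideal generated by `C`, of order lower by two.  The argument in `C` is moved to the innermost
place; as the torsion vanishes on it, only curvature terms arise on the way. -/
theorem scalarIter_mem_of_mem {h : IsCompl C V} (hC : IsInvolutive C)
    (hD : D.IsTorsionQuasiFree h) (k : ℕ) (v : Fin (k + 1) → VF A) (i : Fin (k + 1))
    (hi : v i ∈ C) : D.scalarIter (k + 1) v ∈ scalarIdeal C ⊔ D.scalarLT k := by
  induction k with
  | zero =>
    have e : D.scalarIter 1 v = ((v 0 : VF A) : A →ₗ[ℝ] A) := by
      rw [← Fin.cons_self_tail v, scalarIter_cons, scalarIter_zero]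
      simp only [Finset.univ_eq_empty, Finset.sum_empty, sub_zero]
      rfl
    rw [e]
    rw [Fin.fin_one_eq_zero i] at hi
    exact Submodule.mem_sup_left (coe_mem_scalarIdeal hi)
  | succ k ih =>
    have inner : ∀ (X : VF A) (w : Fin (k + 1) → VF A) (j : Fin (k + 1)), w j ∈ C →
        D.scalarIter (k + 2) (Fin.cons X w) ∈ scalarIdeal C ⊔ D.scalarLT (k + 1) := by
      intro X w j hj
      rw [scalarIter_cons]
      refine sub_mem ?_ (sum_mem fun l _ => ?_)
      · obtain ⟨a, ha, b, hb, e⟩ := Submodule.mem_sup.1 (ih w j hj)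
        rw [← e, vfComp_add]
        exact Submodule.add_mem_sup (vfComp_mem_scalarIdeal X ha) (D.vfComp_mem_scalarLT X hb)
      · refine sup_le_sup_left (D.scalarLT_mono k.le_succ) _ (ih _ j ?_)
        by_cases hl : j = l
        · subst hl
          rw [Function.update_self]
          exact D.cov_mem_left h X hj
        · rwa [Function.update_of_ne hl]
    obtain ⟨X, w, rfl⟩ : ∃ X w, v = Fin.cons X w := ⟨_, _, (Fin.cons_self_tail v).symm⟩
    induction i using Fin.cases with
    | succ j => exact inner X w j hi
    | zero =>
      obtain ⟨Y, z, rfl⟩ : ∃ Y z, w = Fin.cons Y z := ⟨_, _, (Fin.cons_self_tail w).symm⟩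
      rw [← sub_add_cancel (D.scalarIter (k + 2) (Fin.cons X (Fin.cons Y z)))
        (D.scalarIter (k + 2) (Fin.cons Y (Fin.cons X z)))]
      exact add_mem (Submodule.mem_sup_right
        (D.scalarIter_swap_mem (hD.torsion_eq_zero hC hi Y) k z)) (inner Y _ 0 hi)

/-! ### Symmetrization -/

theorem prod_mem_scalarLT (l : List (VF A)) :
    (l.map fun X : VF A => ((X : A →ₗ[ℝ] A) : Module.End ℝ A)).prod
      ∈ D.scalarLT (l.length + 1) := by
  induction l with
  | nil =>
    rw [List.map_nil, List.prod_nil, ← D.scalarIter_zero Fin.elim0]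
    exact D.scalarIter_mem_scalarLT (by simp) _
  | cons X l ih =>
    rw [List.map_cons, List.prod_cons]
    exact D.vfComp_mem_scalarLT X ih

theorem prod_sub_prod_mem_scalarLT {l l' : List (VF A)} (h : l.Perm l') :
    (l.map fun X : VF A => ((X : A →ₗ[ℝ] A) : Module.End ℝ A)).prod -
      (l'.map fun X : VF A => ((X : A →ₗ[ℝ] A) : Module.End ℝ A)).prod
      ∈ D.scalarLT l.length := by
  induction h with
  | nil => simp
  | cons X _ ih =>
    simp only [List.map_cons, List.prod_cons, List.length_cons, ← mul_sub]
    exact D.vfComp_mem_scalarLT X ih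
  | swap X Y l =>
    have := D.vfComp_mem_scalarLT ⁅Y, X⁆ (D.prod_mem_scalarLT l)
    simp only [List.map_cons, List.prod_cons, List.length_cons]
    convert this using 1
    ext f
    exact (Derivation.commutator_apply (D1 := Y) (D2 := X) _).symm
  | trans h₁ _ ih₁ ih₂ =>
    rw [← h₁.length_eq] at ih₂
    simpa using add_mem ih₁ ih₂

theorem scalarIter_sub_prod_mem_scalarLT (k : ℕ) (v : Fin k → VF A) :
    D.scalarIter k v -
      ((List.ofFn v).map fun X : VF A => ((X : A →ₗ[ℝ] A) : Module.End ℝ A)).prod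
      ∈ D.scalarLT k := by
  induction k with
  | zero => rw [scalarIter_zero]; simp
  | succ k ih =>
    obtain ⟨X, w, rfl⟩ : ∃ X w, v = Fin.cons X w := ⟨_, _, (Fin.cons_self_tail v).symm⟩
    rw [scalarIter_cons, List.ofFn_cons, List.map_cons, List.prod_cons, sub_right_comm]
    refine sub_mem ?_ (sum_mem fun i _ => D.scalarIter_mem_scalarLT k.lt_succ_self _)
    have := D.vfComp_mem_scalarLT X (ih w)
    rwa [vfComp_sub] at this

theorem scalarIter_sub_perm_mem_scalarLT (k : ℕ) (v : Fin k → VF A) (σ : Equiv.Perm (Fin k)) :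
    D.scalarIter k v - D.scalarIter k (v ∘ σ) ∈ D.scalarLT k := by
  have h₁ := D.scalarIter_sub_prod_mem_scalarLT k v
  have h₂ := D.scalarIter_sub_prod_mem_scalarLT k (v ∘ σ)
  have h₃ := D.prod_sub_prod_mem_scalarLT (σ.ofFn_comp_perm v).symm
  rw [List.length_ofFn] at h₃
  convert sub_mem (add_mem h₁ h₃) h₂ using 1
  abel

/-- `∇_P` on functions, for a symmetric contravariant tensor `P`. -/
def scalarSym : SymmetricAlgebra A (VF A) →ₗ[A] Module.End ℝ A := scalarPart C ∘ₗ D.nablaSym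

theorem scalarSym_prod {k : ℕ} (v : Fin k → VF A) :
    D.scalarSym (List.ofFn fun i => SymmetricAlgebra.ι A (VF A) (v i)).prod =
      algebraMap ℝ A ((k.factorial : ℝ)⁻¹) •
        ∑ σ : Equiv.Perm (Fin k), D.scalarIter k (v ∘ σ) := by
  change scalarPart C (symLift D.nablaIter _) = _
  rw [symLift_prod, map_smul, map_sum]
  rfl

theorem scalarIter_sub_scalarSym_mem_scalarLT (k : ℕ) (v : Fin k → VF A) :
    D.scalarIter k v - D.scalarSym (List.ofFn fun i => SymmetricAlgebra.ι A (VF A) (v i)).prod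
      ∈ D.scalarLT k := by
  have e : D.scalarIter k v = algebraMap ℝ A ((k.factorial : ℝ)⁻¹) •
      ∑ _σ : Equiv.Perm (Fin k), D.scalarIter k v := by
    rw [Finset.sum_const, Finset.card_univ, Fintype.card_perm, Fintype.card_fin,
      ← Nat.cast_smul_eq_nsmul A, smul_smul, ← map_natCast (algebraMap ℝ A), ← map_mul,
      inv_mul_cancel₀ (by positivity), map_one, one_smul]
  have hs := Submodule.smul_mem _ (algebraMap ℝ A ((k.factorial : ℝ)⁻¹))
    (sum_mem fun (σ : Equiv.Perm (Fin k)) (_ : σ ∈ Finset.univ) =>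
      D.scalarIter_sub_perm_mem_scalarLT k v σ)
  rw [Finset.sum_sub_distrib] at hs
  rw [scalarSym_prod, e]
  convert! hs using 1
  exact (smul_sub _ _ _).symm

theorem nablaSym_algebraMap (P : SymmetricAlgebra A (VF A)) (f : A) :
    D.nablaSym P (algebraMap A _ f) = algebraMap A _ (D.scalarSym P f) := by
  let S : Submodule A (Module.End ℝ (BarΛ C)) :=
    { carrier := {φ | ∀ f : A, φ (algebraMap A _ f) = algebraMap A _ (scalarPart C φ f)}
      zero_mem' := fun f => by simp
      add_mem' := fun hφ hψ f => by
        rw [LinearMap.add_apply, hφ f, hψ f, map_add, LinearMap.add_apply, map_add]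
      smul_mem' := fun a φ hφ f => by
        rw [LinearMap.smul_apply, hφ f, map_smul, LinearMap.smul_apply, smul_eq_mul, map_mul,
          Algebra.smul_def] }
  exact symLift_mem D.nablaIter S (fun k v f => D.nablaIter_algebraMap k v f) P f

end AdaptedConnection

/-! ### Classes of operators with values in longitudinal forms -/

/-- `φ ↦ (f ↦ φ(f) η)`. -/
def smulForm (η : BarΛ C) : Module.End ℝ A →ₗ[A] (A →ₗ[ℝ] BarΛ C) where
  toFun φ := (LinearMap.toSpanSingleton A (BarΛ C) η).restrictScalars ℝ ∘ₗ φ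
  map_add' φ ψ := by ext f; simp [add_smul]
  map_smul' a φ := by ext f; simp [mul_smul]

theorem smulForm_mem_fnDiffOp (η : BarΛ C) {φ : Module.End ℝ A} (h : φ ∈ fnDiffOp A A) :
    smulForm η φ ∈ fnDiffOp A (BarΛ C) := by
  rw [mem_fnDiffOp] at h ⊢
  obtain ⟨k, hk⟩ := h
  have e : ∀ (a : A) (φ : Module.End ℝ A),
      fnComm A (BarΛ C) a (smulForm η φ) = smulForm η (fnComm A A a φ) := by
    intro a φ
    ext f
    change a • φ f • η - φ (a * f) • η = (a * φ f - φ (a * f)) • η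
    rw [sub_smul, mul_smul]
  refine ⟨k, ?_⟩
  induction k generalizing φ with
  | zero =>
    simp only [fnDiffOpOrder, Submodule.mem_iInf, Submodule.mem_comap, Submodule.mem_bot] at hk ⊢
    intro a
    rw [e, hk a, map_zero]
  | succ k ih =>
    simp only [fnDiffOpOrder, Submodule.mem_iInf, Submodule.mem_comap] at hk ⊢
    intro a
    rw [e]
    exact ih (hk a)

/-- The class of `f ↦ φ(f) η` in the module of normal differential operators. -/
def formClass (η : BarΛ C) : fnDiffOp A A →ₗ[A] NormalOp C (BarΛ C) :=
  normalClass C (BarΛ C) ∘ₗ (smulForm η).restrict fun _ h => smulForm_mem_fnDiffOp η h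

theorem canProj_eq_formClass {φ : diffOp A (BarForm C)} {η : BarΛ C} {ψ : Module.End ℝ A}
    (hψ : ψ ∈ fnDiffOp A A)
    (h : ∀ f, (φ : Module.End ℝ (BarΛ C)) (algebraMap A _ f) = ψ f • η) :
    canProj C φ = formClass η ⟨ψ, hψ⟩ :=
  congrArg (normalClass C (BarΛ C)) (Subtype.ext (LinearMap.ext h))

theorem scalarIdeal_le_fnDiffOp : scalarIdeal C ≤ fnDiffOp A A := by
  refine Submodule.span_le.2 ?_
  rintro _ ⟨φ, hφ, X, -, rfl⟩
  have key : ∀ (k : ℕ) (φ : Module.End ℝ A), φ ∈ fnDiffOpOrder A A k →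
      φ ∘ₗ (X : A →ₗ[ℝ] A) ∈ fnDiffOpOrder A A (k + 1) := by
    intro k
    have e : ∀ (a : A) (φ : Module.End ℝ A), fnComm A A a (φ ∘ₗ (X : A →ₗ[ℝ] A)) =
        fnComm A A a φ ∘ₗ (X : A →ₗ[ℝ] A) + fnComm A A (X a) φ - X a • φ := by
      intro a φ
      ext f
      change a * φ (X f) - φ (X (a * f)) =
        a * φ (X f) - φ (a * X f) + (X a * φ f - φ (X a * f)) - X a * φ f
      rw [Derivation.leibniz, smul_eq_mul, smul_eq_mul, map_add, mul_comm f]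
      ring
    induction k with
    | zero =>
      intro φ hk
      have hk' := hk
      simp only [fnDiffOpOrder, Submodule.mem_iInf, Submodule.mem_comap, Submodule.mem_bot]
        at hk' ⊢
      intro a b
      rw [e, hk' a, hk' (X a), LinearMap.zero_comp, zero_add, zero_sub, map_neg, map_smul, hk' b,
        smul_zero, neg_zero]
    | succ k ih =>
      intro φ hk
      have hk' := hk
      simp only [fnDiffOpOrder, Submodule.mem_iInf, Submodule.mem_comap] at hk'
      rw [fnDiffOpOrder]
      simp only [Submodule.mem_iInf, Submodule.mem_comap]
      intro a
      rw [e]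
      exact sub_mem (add_mem (ih _ (hk' a)) (fnDiffOpOrder_le_succ A k (hk' (X a))))
        (Submodule.smul_mem _ _ hk)
  obtain ⟨k, hk⟩ := mem_fnDiffOp.1 hφ
  exact mem_fnDiffOp.2 ⟨k + 1, key k φ hk⟩

theorem formClass_eq_zero (η : BarΛ C) {ψ : Module.End ℝ A} (h : ψ ∈ scalarIdeal C) :
    formClass η ⟨ψ, scalarIdeal_le_fnDiffOp h⟩ = 0 := by
  refine (Submodule.Quotient.mk_eq_zero _).2 ?_
  have hle : scalarIdeal C ≤ ((compC C (BarΛ C)).map (fnDiffOp A (BarΛ C)).subtype).comap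
      (smulForm η) := by
    refine Submodule.span_le.2 ?_
    rintro _ ⟨φ, hφ, X, hX, rfl⟩
    have hm : smulForm η (φ ∘ₗ (X : A →ₗ[ℝ] A)) ∈ fnDiffOp A (BarΛ C) :=
      smulForm_mem_fnDiffOp η
        (scalarIdeal_le_fnDiffOp (Submodule.subset_span ⟨φ, hφ, X, hX, rfl⟩))
    exact ⟨⟨_, hm⟩, Submodule.subset_span
      ⟨⟨_, smulForm_mem_fnDiffOp η hφ⟩, X, hX, rfl⟩, rfl⟩
  obtain ⟨χ, hχ, e⟩ := hle h
  have e' : χ = ⟨smulForm η ψ, smulForm_mem_fnDiffOp η (scalarIdeal_le_fnDiffOp h)⟩ :=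
    Subtype.ext e
  rw [e'] at hχ
  exact hχ

/-! ### Generators of symmetric powers -/

section SymPow
variable {X : Type*} [AddCommGroup X] [Module A X]

theorem symPow_eq_span (k : ℕ) : symPow (A := A) X k =
    Submodule.span A {P | ∃ l : List X, l.length = k ∧ P = (l.map (SymmetricAlgebra.ι A X)).prod}
    := by
  induction k with
  | zero =>
    rw [symPow, pow_zero, Submodule.one_eq_span]
    congr 1
    ext P
    simp
  | succ k ih =>
    rw [symPow, pow_succ']
    change _ * symPow X k = _
    rw [ih, ← Submodule.span_eq (LinearMap.range (SymmetricAlgebra.ι A X)),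
      Submodule.span_mul_span]
    congr 1
    ext P
    constructor
    · rintro ⟨_, ⟨x, rfl⟩, _, ⟨l, hl, rfl⟩, rfl⟩
      exact ⟨x :: l, by simp [hl], by simp⟩
    · rintro ⟨l, hl, rfl⟩
      obtain ⟨x, l, rfl⟩ := List.exists_cons_of_length_eq_add_one hl
      exact ⟨_, ⟨x, rfl⟩, _, ⟨l, by simpa using hl, rfl⟩, by simp⟩

theorem symPow_algebraMapInv {k : ℕ} {P : SymmetricAlgebra A X} (h : P ∈ symPow X (k + 1)) :
    SymmetricAlgebra.algebraMapInv P = 0 := by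
  rw [symPow_eq_span] at h
  refine Submodule.span_induction ?_ (map_zero _) (fun _ _ _ _ h h' => by rw [map_add, h, h',
    add_zero]) (fun a _ _ h => by rw [map_smul, h, smul_zero]) h
  rintro _ ⟨l, hl, rfl⟩
  obtain ⟨x, l, rfl⟩ := List.exists_cons_of_length_eq_add_one hl
  rw [List.map_cons, List.prod_cons, map_mul, SymmetricAlgebra.algebraMapInv_ι, zero_mul]

theorem exteriorPower_algebraMapInv {k : ℕ} {x : ExteriorAlgebra A X} (h : x ∈ ⋀[A]^(k + 1) X) :
    ExteriorAlgebra.algebraMapInv x = 0 := by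
  replace h : x ∈ LinearMap.range (ExteriorAlgebra.ι A) ^ k *
    LinearMap.range (ExteriorAlgebra.ι A) := h
  refine Submodule.mul_induction_on h ?_ fun _ _ h h' => by rw [map_add, h, h', add_zero]
  rintro y - _ ⟨X, rfl⟩
  rw [map_mul]
  exact (congrArg _ (ExteriorAlgebra.lift_ι_apply _ _ _ _)).trans (mul_zero _)

end SymPow

theorem interior_algebraMap {k : ℕ} {x : ExteriorAlgebra A C} (h : x ∈ ⋀[A]^(k + 1) C) (f : A) :
    interior C x (algebraMap A _ f) = 0 := by
  replace h : x ∈ LinearMap.range (ExteriorAlgebra.ι A) ^ k *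
    LinearMap.range (ExteriorAlgebra.ι A) := h
  refine Submodule.mul_induction_on h ?_ fun _ _ h h' => by
    rw [map_add, LinearMap.add_apply, h, h', add_zero]
  rintro y - _ ⟨X, rfl⟩
  rw [map_mul, Module.End.mul_apply, interior, ExteriorAlgebra.lift_ι_apply]
  exact (congrArg _ (CliffordAlgebra.contractLeft_algebraMap _ _ f)).trans (map_zero _)

theorem sub_mem_of_mem_span {M G : Type*} [AddCommGroup M] [Module A M]
    [AddCommGroup G] [Module A G] {p q : M →ₗ[A] G} {O : Submodule A G} {S : Set M}
    (h : ∀ s ∈ S, (p s ∈ O ∧ q s = 0) ∨ p s = q s) {s : M} (hs : s ∈ Submodule.span A S) :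
    p s - q s ∈ O := by
  refine (Submodule.span_le (p := O.comap (p - q))).2 (fun t ht => ?_) hs
  change p t - q t ∈ O
  rcases h t ht with ⟨h₁, h₂⟩ | h
  · rwa [h₂, sub_zero]
  · rw [h, sub_self]
    exact zero_mem _

namespace AdaptedConnection

variable (D : AdaptedConnection C V)

/-! ### The order filtration of normal differential operators -/

theorem scalarIter_mem_fnDiffOp (k : ℕ) (v : Fin k → VF A) : D.scalarIter k v ∈ fnDiffOp A A := by
  induction k with
  | zero => rw [scalarIter_zero]; exact one_mem_fnDiffOp
  | succ k ih =>
    rw [← Fin.cons_self_tail v, scalarIter_cons]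
    exact sub_mem (vfComp_mem_fnDiffOp _ (ih _)) (sum_mem fun i _ => ih _)

theorem scalarSym_mem_fnDiffOp (P : SymmetricAlgebra A (VF A)) :
    D.scalarSym P ∈ fnDiffOp A A :=
  symLift_mem D.nablaIter ((fnDiffOp A A).comap (scalarPart C)) D.scalarIter_mem_fnDiffOp P

/-- The scalar differential operators `φ` for which `f ↦ φ(f) η` has a class of order at most
`k`. -/
def scalarOrderLE (η : BarΛ C) (k : ℤ) : Submodule A (Module.End ℝ A) :=
  ((D.orderLE k).comap (formClass η)).map (fnDiffOp A A).subtype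

theorem mem_scalarOrderLE {η : BarΛ C} {k : ℤ} {φ : Module.End ℝ A} (h : φ ∈ fnDiffOp A A) :
    φ ∈ D.scalarOrderLE η k ↔ formClass η ⟨φ, h⟩ ∈ D.orderLE k := by
  constructor
  · rintro ⟨ψ, hψ, rfl⟩
    exact hψ
  · exact fun hφ => ⟨_, hφ, rfl⟩

theorem orderLE_mono {k l : ℤ} (h : k ≤ l) : D.orderLE k ≤ D.orderLE l :=
  iSup_mono fun _ => iSup_mono' fun hj => ⟨hj.trans h, le_rfl⟩

theorem scalarOrderLE_mono (η : BarΛ C) {k l : ℤ} (h : k ≤ l) :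
    D.scalarOrderLE η k ≤ D.scalarOrderLE η l :=
  Submodule.map_mono (Submodule.comap_mono (D.orderLE_mono h))

theorem scalarIdeal_le_scalarOrderLE (η : BarΛ C) (k : ℤ) :
    scalarIdeal C ≤ D.scalarOrderLE η k := fun φ hφ => by
  rw [mem_scalarOrderLE D (scalarIdeal_le_fnDiffOp hφ), formClass_eq_zero η hφ]
  exact zero_mem _

theorem pbwBar_tmul (η : BarΛ C) (Q : SymmetricAlgebra A V) :
    D.pbwBar (η ⊗ₜ Q) = formClass η ⟨D.scalarSym (SymmetricAlgebra.lift
      (SymmetricAlgebra.ι A (VF A) ∘ₗ V.subtype) Q), D.scalarSym_mem_fnDiffOp _⟩ := by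
  refine canProj_eq_formClass (φ := ⟨D.pbwBarEnd (η ⊗ₜ Q), D.pbwBarEnd_mem _⟩) _ fun f => ?_
  change η * D.nablaSym _ (algebraMap A _ f) = _
  rw [nablaSym_algebraMap, ← Algebra.commutes, Algebra.smul_def]
  rfl

/-- Every iterated covariant derivative of functions is, up to the ideal generated by `C`, a
combination of symmetrized covariant derivatives along `V` of no higher order. -/
theorem scalarIter_mem_scalarOrderLE {h : IsCompl C V} (hC : IsInvolutive C)
    (hD : D.IsTorsionQuasiFree h) (η : BarΛ C) (k : ℕ) (v : Fin k → VF A) :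
    D.scalarIter k v ∈ D.scalarOrderLE η k := by
  induction k using Nat.strong_induction_on with
  | _ k ih =>
  have hlt : ∀ n ≤ k, D.scalarLT n ≤ D.scalarOrderLE η k := fun n hn => by
    refine Submodule.span_le.2 ?_
    rintro _ ⟨j, hj, w, rfl⟩
    exact D.scalarOrderLE_mono η (by omega) (ih j (by omega) w)
  -- The arguments are split into their parts in `C` and in `V`, and the derivative is expanded.
  have e : v = (fun i => C.projection V h (v i)) + fun i => V.projection C h.symm (v i) :=
    funext fun i => (Submodule.projection_add_projection_eq_self h (v i)).symm
  rw [e, MultilinearMap.map_add_univ]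
  refine sum_mem fun s _ => ?_
  rcases s.eq_empty_or_nonempty with rfl | ⟨i, hi⟩
  · rw [Finset.piecewise_empty]
    refine (Submodule.sub_mem_iff_left _ ?_).1
      (hlt k le_rfl (D.scalarIter_sub_scalarSym_mem_scalarLT k _))
    rw [mem_scalarOrderLE D (D.scalarSym_mem_fnDiffOp _)]
    have hmem := Submodule.mem_map_of_mem (f := D.pbwBar) (show
      η ⊗ₜ[A] (List.ofFn fun i => SymmetricAlgebra.ι A V (V.projectionOnto C h.symm (v i))).prod ∈
        normalSymbOrder C V k from Submodule.subset_span ⟨η, _, by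
          rw [symPow_eq_span]
          exact Submodule.subset_span ⟨List.ofFn fun i => V.projectionOnto C h.symm (v i),
            by simp, by rw [List.map_ofFn]; rfl⟩, rfl⟩)
    rw [pbwBar_tmul] at hmem
    have hle : (normalSymbOrder C V k).map D.pbwBar ≤ D.orderLE k :=
      le_iSup₂_of_le k le_rfl le_rfl
    convert hle hmem using 4
    rw [map_list_prod, List.map_ofFn]
    congr 2
    funext i
    exact (SymmetricAlgebra.lift_ι_apply (SymmetricAlgebra.ι A (VF A) ∘ₗ V.subtype) _).symm
  · cases k with
    | zero => exact i.elim0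
    | succ k =>
      refine sup_le (D.scalarIdeal_le_scalarOrderLE η _) (hlt k k.le_succ)
        (D.scalarIter_mem_of_mem hC hD k _ i ?_)
      rw [Finset.piecewise_eq_of_mem _ _ _ hi]
      exact Submodule.projection_apply_mem h _

theorem scalarLT_le_scalarOrderLE {h : IsCompl C V} (hC : IsInvolutive C)
    (hD : D.IsTorsionQuasiFree h) (η : BarΛ C) (n : ℕ) :
    D.scalarLT n ≤ D.scalarOrderLE η (n - 1) := by
  refine Submodule.span_le.2 ?_
  rintro _ ⟨j, hj, w, rfl⟩
  exact D.scalarOrderLE_mono η (by omega) (D.scalarIter_mem_scalarOrderLE hC hD η j w)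

/-! ### The projection of symbols -/

theorem scalarSym_list_mem {h : IsCompl C V} (hC : IsInvolutive C)
    (hD : D.IsTorsionQuasiFree h) {k : ℕ} {L : List (VF A)} (hL : L.length = k + 1)
    {X : VF A} (hX : X ∈ C) (hXL : X ∈ L) :
    D.scalarSym (L.map (SymmetricAlgebra.ι A (VF A))).prod ∈ scalarIdeal C ⊔ D.scalarLT k := by
  obtain ⟨v, rfl⟩ : ∃ v : Fin (k + 1) → VF A, L = List.ofFn v := by
    refine ⟨fun i => L.get (i.cast hL.symm), List.ext_getElem ?_ fun i _ _ => ?_⟩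
    · exact hL.trans List.length_ofFn.symm
    · rw [List.getElem_ofFn]
      rfl
  obtain ⟨i, rfl⟩ := List.mem_ofFn.1 hXL
  rw [List.map_ofFn]
  change D.scalarSym (List.ofFn fun i => SymmetricAlgebra.ι A (VF A) (v i)).prod ∈ _
  rw [scalarSym_prod]
  refine Submodule.smul_mem _ _ (sum_mem fun σ _ => ?_)
  refine D.scalarIter_mem_of_mem hC hD k _ (σ.symm i) ?_
  rwa [Function.comp_apply, Equiv.apply_symm_apply]

theorem scalarSym_symMul_mem {h : IsCompl C V} (hC : IsInvolutive C)
    (hD : D.IsTorsionQuasiFree h) {l m : ℕ} {P : SymmetricAlgebra A C} (hP : P ∈ symPow C (l + 1))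
    {Q : SymmetricAlgebra A V} (hQ : Q ∈ symPow V m) :
    D.scalarSym (symMul C V (P ⊗ₜ Q)) ∈ scalarIdeal C ⊔ D.scalarLT (l + m) := by
  rw [symPow_eq_span] at hP hQ
  induction hP using Submodule.span_induction with
  | zero => rw [TensorProduct.zero_tmul, map_zero, map_zero]; exact zero_mem _
  | add P P' _ _ h h' => rw [TensorProduct.add_tmul, map_add, map_add]; exact add_mem h h'
  | smul a P _ h =>
    rw [← TensorProduct.smul_tmul', map_smul, map_smul]; exact Submodule.smul_mem _ _ h
  | mem P hP =>
    obtain ⟨p, hp, rfl⟩ := hP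
    induction hQ using Submodule.span_induction with
    | zero => rw [TensorProduct.tmul_zero, map_zero, map_zero]; exact zero_mem _
    | add P P' _ _ h h' => rw [TensorProduct.tmul_add, map_add, map_add]; exact add_mem h h'
    | smul a P _ h =>
      rw [TensorProduct.tmul_smul, map_smul, map_smul]; exact Submodule.smul_mem _ _ h
    | mem Q hQ =>
      obtain ⟨q, hq, rfl⟩ := hQ
      have e : symMul C V ((p.map (SymmetricAlgebra.ι A C)).prod ⊗ₜ
          (q.map (SymmetricAlgebra.ι A V)).prod) =
          ((p.map C.subtype ++ q.map V.subtype).map (SymmetricAlgebra.ι A (VF A))).prod := by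
        change SymmetricAlgebra.lift (SymmetricAlgebra.ι A (VF A) ∘ₗ C.subtype) _ *
          SymmetricAlgebra.lift (SymmetricAlgebra.ι A (VF A) ∘ₗ V.subtype) _ = _
        rw [map_list_prod, map_list_prod, List.map_append, List.prod_append, List.map_map,
          List.map_map, List.map_map, List.map_map]
        congr 3
        · exact funext fun _ =>
            SymmetricAlgebra.lift_ι_apply (SymmetricAlgebra.ι A (VF A) ∘ₗ C.subtype) _
        · exact funext fun _ =>
            SymmetricAlgebra.lift_ι_apply (SymmetricAlgebra.ι A (VF A) ∘ₗ V.subtype) _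
      rw [e]
      obtain ⟨x, p, rfl⟩ := List.exists_cons_of_length_eq_add_one hp
      refine D.scalarSym_list_mem hC hD ?_ x.2 (by simp)
      rw [List.length_cons] at hp
      simp
      omega

theorem symbProj_tmul (η : BarΛ C) (x : ExteriorAlgebra A C) (P : SymmetricAlgebra A C)
    (Q : SymmetricAlgebra A V) : symbProj C V (η ⊗ₜ (x ⊗ₜ (P ⊗ₜ Q))) =
      η ⊗ₜ (ExteriorAlgebra.algebraMapInv x • SymmetricAlgebra.algebraMapInv P • Q) := rfl

theorem symbProj_tmul_of_mem_exteriorPower (η : BarΛ C) {k : ℕ} {x : ExteriorAlgebra A C}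
    (hx : x ∈ ⋀[A]^(k + 1) C) (P : SymmetricAlgebra A C) (Q : SymmetricAlgebra A V) :
    symbProj C V (η ⊗ₜ (x ⊗ₜ (P ⊗ₜ Q))) = 0 := by
  rw [symbProj_tmul, exteriorPower_algebraMapInv hx, zero_smul, TensorProduct.tmul_zero]

theorem symbProj_tmul_of_mem_symPow (η : BarΛ C) (x : ExteriorAlgebra A C) {l : ℕ}
    {P : SymmetricAlgebra A C} (hP : P ∈ symPow C (l + 1)) (Q : SymmetricAlgebra A V) :
    symbProj C V (η ⊗ₜ (x ⊗ₜ (P ⊗ₜ Q))) = 0 := by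
  rw [symbProj_tmul, symPow_algebraMapInv hP, zero_smul, smul_zero, TensorProduct.tmul_zero]

theorem pbw_tmul_algebraMap (η : BarΛ C) (x : ExteriorAlgebra A C) (P : SymmetricAlgebra A C)
    (Q : SymmetricAlgebra A V) (f : A) :
    (D.pbw (η ⊗ₜ (x ⊗ₜ (P ⊗ₜ Q))) : Module.End ℝ (BarΛ C)) (algebraMap A _ f) =
      η * interior C x (algebraMap A _ (D.scalarSym (symMul C V (P ⊗ₜ Q)) f)) := by
  rw [← nablaSym_algebraMap]
  rfl

/-- Interior products kill functions. -/
theorem canProj_pbw_eq_zero {k : ℕ} {x : ExteriorAlgebra A C} (hx : x ∈ ⋀[A]^(k + 1) C)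
    (η : BarΛ C) (P : SymmetricAlgebra A C) (Q : SymmetricAlgebra A V) :
    canProj C (D.pbw (η ⊗ₜ (x ⊗ₜ (P ⊗ₜ Q)))) = 0 := by
  rw [canProj_eq_formClass (η := 0) (zero_mem _) fun f => ?_]
  · exact map_zero (formClass (0 : BarΛ C))
  · rw [pbw_tmul_algebraMap, interior_algebraMap hx, mul_zero, smul_zero]

theorem interior_of_mem_zero {x : ExteriorAlgebra A C} (hx : x ∈ ⋀[A]^0 C) (η : BarΛ C) :
    interior C x η = ExteriorAlgebra.algebraMapInv x • η := by
  obtain ⟨r, rfl⟩ := Submodule.mem_one.1 hx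
  rw [AlgHom.commutes, Module.algebraMap_end_apply, ExteriorAlgebra.algebraMap_leftInverse]

theorem canProj_pbw_of_mem_zero {x : ExteriorAlgebra A C} (hx : x ∈ ⋀[A]^0 C) (η : BarΛ C)
    (P : SymmetricAlgebra A C) (Q : SymmetricAlgebra A V) :
    canProj C (D.pbw (η ⊗ₜ (x ⊗ₜ (P ⊗ₜ Q)))) =
      formClass η ⟨ExteriorAlgebra.algebraMapInv x • D.scalarSym (symMul C V (P ⊗ₜ Q)),
        Submodule.smul_mem _ _ (D.scalarSym_mem_fnDiffOp _)⟩ := by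
  refine canProj_eq_formClass _ fun f => ?_
  rw [pbw_tmul_algebraMap, interior_of_mem_zero hx, mul_smul_comm, ← Algebra.commutes,
    ← Algebra.smul_def, smul_smul]
  rfl

theorem symMul_of_mem_zero {P : SymmetricAlgebra A C} (hP : P ∈ symPow C 0)
    (Q : SymmetricAlgebra A V) : symMul C V (P ⊗ₜ Q) = SymmetricAlgebra.lift
      (SymmetricAlgebra.ι A (VF A) ∘ₗ V.subtype) (SymmetricAlgebra.algebraMapInv P • Q) := by
  obtain ⟨c, rfl⟩ := Submodule.mem_one.1 hP
  change SymmetricAlgebra.lift (SymmetricAlgebra.ι A (VF A) ∘ₗ C.subtype) (algebraMap A _ c) *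
    SymmetricAlgebra.lift (SymmetricAlgebra.ι A (VF A) ∘ₗ V.subtype) Q = _
  rw [AlgHom.commutes, ← Algebra.smul_def, SymmetricAlgebra.algebraMap_leftInverse, map_smul]

/-- On a decomposable symbol, `p` agrees with `p₀` if there are no factors from `C`, and lowers the
order by at least two otherwise. -/
theorem canProj_pbw_tmul {h : IsCompl C V} (hC : IsInvolutive C)
    (hD : D.IsTorsionQuasiFree h) {H k l m : ℕ} (hH : k + l + m = H) (η : BarΛ C)
    {x : ExteriorAlgebra A C} (hx : x ∈ ⋀[A]^k C) {P : SymmetricAlgebra A C} (hP : P ∈ symPow C l)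
    {Q : SymmetricAlgebra A V} (hQ : Q ∈ symPow V m) :
    (canProj C (D.pbw (η ⊗ₜ (x ⊗ₜ (P ⊗ₜ Q)))) ∈ D.orderLE (H - 2) ∧
      D.pbwBar (symbProj C V (η ⊗ₜ (x ⊗ₜ (P ⊗ₜ Q)))) = 0) ∨
    canProj C (D.pbw (η ⊗ₜ (x ⊗ₜ (P ⊗ₜ Q)))) =
      D.pbwBar (symbProj C V (η ⊗ₜ (x ⊗ₜ (P ⊗ₜ Q)))) := by
  cases k with
  | succ k =>
    refine Or.inl ⟨?_, ?_⟩
    · rw [D.canProj_pbw_eq_zero hx]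
      exact zero_mem _
    · exact (congrArg D.pbwBar (symbProj_tmul_of_mem_exteriorPower η hx P Q)).trans
        D.pbwBar.map_zero
  | zero =>
    have hr := D.canProj_pbw_of_mem_zero hx η P Q
    cases l with
    | succ l =>
      refine Or.inl ⟨?_, ?_⟩
      · have hle : scalarIdeal C ⊔ D.scalarLT (l + m) ≤ D.scalarOrderLE η (H - 2) :=
          sup_le (D.scalarIdeal_le_scalarOrderLE η _)
            ((D.scalarLT_le_scalarOrderLE hC hD η (l + m)).trans
              (D.scalarOrderLE_mono η (by omega)))
        rw [hr, ← mem_scalarOrderLE]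
        exact Submodule.smul_mem _ _ (hle (D.scalarSym_symMul_mem hC hD hP hQ))
      · exact (congrArg D.pbwBar (symbProj_tmul_of_mem_symPow η x hP Q)).trans
          D.pbwBar.map_zero
    | zero =>
      refine Or.inr (hr.trans ?_)
      rw [symbProj_tmul, pbwBar_tmul]
      refine congrArg _ (Subtype.ext ?_)
      change ExteriorAlgebra.algebraMapInv x • D.scalarSym _ = D.scalarSym _
      rw [symMul_of_mem_zero hP, map_smul _ (ExteriorAlgebra.algebraMapInv x),
        map_smul _ (ExteriorAlgebra.algebraMapInv x)]

/-- On symbols of order `H`, the projection `p` agrees with `p₀` up to terms of order at most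
`H - 2`. -/
theorem canProj_pbw_sub_mem {h : IsCompl C V} (hC : IsInvolutive C)
    (hD : D.IsTorsionQuasiFree h) {H : ℕ} {s : Symb C V} (hs : s ∈ symbOrder C V H) :
    canProj C (D.pbw s) - D.pbwBar (symbProj C V s) ∈ D.orderLE (H - 2) := by
  refine sub_mem_of_mem_span (p := canProj C ∘ₗ D.pbw)
    (q := D.pbwBar ∘ₗ symbProj C V) ?_ hs
  rintro _ ⟨k, l, m, hH, η, x, hx, P, hP, Q, hQ, rfl⟩
  exact D.canProj_pbw_tmul hC hD hH η hx hP hQ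

theorem symbProj_mem {H : ℕ} {s : Symb C V} (hs : s ∈ symbOrder C V H) :
    symbProj C V s ∈ normalSymbOrder C V H := by
  refine (Submodule.span_le (p := (normalSymbOrder C V H).comap (symbProj C V))).2 ?_ hs
  rintro _ ⟨k, l, m, hH, η, x, hx, P, hP, Q, hQ, rfl⟩
  change symbProj C V _ ∈ normalSymbOrder C V H
  cases k with
  | succ k =>
    rw [symbProj_tmul_of_mem_exteriorPower η hx]
    exact zero_mem _
  | zero =>
    cases l with
    | succ l =>
      rw [symbProj_tmul_of_mem_symPow η x hP]
      exact zero_mem _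
    | zero =>
      obtain rfl : m = H := by omega
      rw [symbProj_tmul]
      exact Submodule.subset_span
        ⟨η, _, Submodule.smul_mem _ _ (Submodule.smul_mem _ _ hQ), rfl⟩

/-- The families of symbols in `⨁ᵢ Λ̄ ⊗ S^{H+i}V` with no component for `i ≥ -1`. -/
def lowerExpansion (C V : Submodule A (VF A)) (H : ℕ) : Submodule A (ℤ →₀ NormalSymb C V) where
  carrier := {τ | (∀ (i : ℤ) (k : ℕ), (k : ℤ) = H + i → τ i ∈ normalSymbOrder C V k) ∧
    (∀ i : ℤ, H + i < 0 → τ i = 0) ∧ ∀ i ≥ -1, τ i = 0}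
  zero_mem' := ⟨fun _ _ _ => zero_mem _, fun _ _ => rfl, fun _ _ => rfl⟩
  add_mem' := fun ⟨h₁, h₂, h₃⟩ ⟨h₁', h₂', h₃'⟩ =>
    ⟨fun i k hk => add_mem (h₁ i k hk) (h₁' i k hk),
      fun i hi => by rw [Finsupp.add_apply, h₂ i hi, h₂' i hi, add_zero],
      fun i hi => by rw [Finsupp.add_apply, h₃ i hi, h₃' i hi, add_zero]⟩
  smul_mem' := fun a τ ⟨h₁, h₂, h₃⟩ =>
    ⟨fun i k hk => Submodule.smul_mem _ a (h₁ i k hk),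
      fun i hi => by rw [Finsupp.smul_apply, h₂ i hi, smul_zero],
      fun i hi => by rw [Finsupp.smul_apply, h₃ i hi, smul_zero]⟩

theorem orderLE_le_map_lowerExpansion (H : ℕ) : D.orderLE (H - 2) ≤
    (lowerExpansion C V H).map (D.pbwBar ∘ₗ Finsupp.lsum A fun _ : ℤ => LinearMap.id) := by
  refine iSup₂_le fun j hj => ?_
  rintro _ ⟨t, ht, rfl⟩
  refine ⟨Finsupp.single (j - H : ℤ) t, ⟨fun i k hk => ?_, fun i hi => ?_, fun i hi => ?_⟩, ?_⟩
  · by_cases hij : (j - H : ℤ) = i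
    · obtain rfl : k = j := by omega
      rw [hij, Finsupp.single_eq_same]
      exact ht
    · rw [Finsupp.single_apply, if_neg hij]
      exact zero_mem _
  · rw [Finsupp.single_apply, if_neg (by omega)]
  · rw [Finsupp.single_apply, if_neg (by omega)]
  · simp

theorem exists_isOrderExpansion {h : IsCompl C V} (hC : IsInvolutive C)
    (hD : D.IsTorsionQuasiFree h) {H : ℕ} {s : Symb C V} (hs : s ∈ symbOrder C V H) :
    ∃ τ, D.IsOrderExpansion H s τ ∧
      (∀ i > 0, τ i = 0) ∧ τ 0 = symbProj C V s ∧ τ (-1) = 0 := by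
  obtain ⟨τ, ⟨h₁, h₂, h₃⟩, hτ⟩ :=
    D.orderLE_le_map_lowerExpansion H (D.canProj_pbw_sub_mem hC hD hs)
  have e : ∀ i ≠ 0, (Finsupp.single (0 : ℤ) (symbProj C V s) + τ) i = τ i := fun i hi => by
    rw [Finsupp.add_apply, Finsupp.single_eq_of_ne hi, zero_add]
  have e₀ : (Finsupp.single (0 : ℤ) (symbProj C V s) + τ) 0 = symbProj C V s := by
    rw [Finsupp.add_apply, Finsupp.single_eq_same, h₃ 0 (by decide), add_zero]
  refine ⟨Finsupp.single 0 (symbProj C V s) + τ, ⟨fun i k hk => ?_, fun i hi => ?_, ?_⟩,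
    fun i hi => ?_, e₀, ?_⟩
  · by_cases hi : i = 0
    · subst hi
      obtain rfl : k = H := by omega
      rw [e₀]
      exact symbProj_mem hs
    · rw [e i hi]
      exact h₁ i k hk
  · rw [e i (by omega)]
    exact h₂ i hi
  · have hsum : (Finsupp.single (0 : ℤ) (symbProj C V s) + τ).sum (fun _ t => t) =
        symbProj C V s +
          Finsupp.lsum A (fun _ : ℤ => (LinearMap.id : NormalSymb C V →ₗ[A] _)) τ := by
      rw [Finsupp.sum_add_index' (fun _ => rfl) (fun _ _ _ => rfl), Finsupp.sum_single_index rfl]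
      rfl
    rw [hsum]
    exact (sub_eq_iff_eq_add'.1 hτ.symm).trans (D.pbwBar.map_add _ _).symm
  · rw [e i (by omega)]
    exact h₃ i (by omega)
  · rw [e (-1) (by omega)]
    exact h₃ (-1) le_rfl

end AdaptedConnection

end

end FolPBW

open scoped Manifold ContDiff
theorem mainTheorem6 {d n r : ℕ} {M : Type*} [TopologicalSpace M]
    [ChartedSpace (EuclideanSpace ℝ (Fin d)) M] [IsManifold (𝓡 d) ∞ M] [T2Space M]
    [SigmaCompactSpace M]
    (C : FolPBW.Distribution d M n) (hC : FolPBW.IsInvolutive C.sections)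
    (V : FolPBW.Distribution d M r) (hCV : IsCompl C.sections V.sections)
    (D : FolPBW.AdaptedConnection C.sections V.sections) (hD : D.IsTorsionQuasiFree hCV)
    (H : ℕ) (s : FolPBW.Symb C.sections V.sections)
    (hs : s ∈ FolPBW.symbOrder C.sections V.sections H) :
    (∃ τ, D.IsOrderExpansion H s τ ∧
      (∀ i > 0, τ i = 0) ∧ τ 0 = FolPBW.symbProj C.sections V.sections s ∧ τ (-1) = 0) ∧
    FolPBW.canProj C.sections (D.pbw s) -
      D.pbwBar (FolPBW.symbProj C.sections V.sections s) ∈ D.orderLE (H - 2) :=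
  ⟨D.exists_isOrderExpansion hC hD hs, D.canProj_pbw_sub_mem hC hD hs⟩
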